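/- For a partition $\lambda$ let $\ell(\lambda)$ be its number of (nonzero) parts and let $s_\lambda(x_1,\dots,x_p)=\sum_T x^T$ be the Schur function, the sum being over all semistandard Young tableaux $T$ of shape $\lambda$ with entries in $\{1,\dots,p\}$. For a partition $\lambda$ with distinct parts let $g_\lambda$ be the number of standard Young tableaux of shifted shape $\lambda$ (row $i+1$ starts one box to the right of row $i$; each of the entries $1,\dots,|\lambda|$ is used once; entries increase along rows and down columns). For integers $0\le r\le p$ and real $s>-1$ put $$E_1(r,p,s)=\prod_{r<l<2p-r+2}\frac{1}{(l+2s)^{r/2}}\ \prod_{2\le l\le r}\frac{1}{\big((l+2s)(2p-l+2+2s)\big)^{\lfloor l/2\rfloor}}\qquad (r\text{ even}),$$ $$E_1(r,p,s)=\frac{\big(\frac{r-1}{2}+s\big)!}{\big(p-\frac{r-1}{2}+s\big)!}\,E_1(r-1,p,s)\qquad (r\text{ odd}),$$ where $l$ runs over integers, $x!=\Gamma(x+1)$, $x^0=1$ for every real $x$, and empty products are $1$. **Lemma.** Let $p\ge r\ge 0$ be integers, $N=rp-\binom r2$, and let $s>-1$ be real. Then for every $q\in(0,1)$ the series $\sum_{\ell(\lambda)\le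 r}s_\lambda(q^{1+s},\dots,q^{p+s})$ over all partitions $\lambda$ with at most $r$ parts converges, and $$\lim_{q\to1^-}(1-q)^N\sum_{\ell(\lambda)\le r}s_\lambda(q^{1+s},q^{2+s},\dots,q^{p+s})=\frac{g_{(p,p-1,\dots,p-r+1)}}{N!}\cdot\frac{E_1(r,p,s)}{E_1(r,p,0)}.$$ -/

import Mathlib

open scoped Topology

/-- Semistandard Young tableaux of shape `μ` with entries in an alphabet of `p` letters,
here `0, 1, …, p - 1`; the letter `i` stands for the entry `i + 1`. -/
def BoundedSSYT (p : ℕ) (μ : YoungDiagram) : Type :=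
  {T : SemistandardYoungTableau μ // ∀ c ∈ μ.cells, T c.1 c.2 < p}

instance BoundedSSYT.instFinite (p : ℕ) (μ : YoungDiagram) : Finite (BoundedSSYT p μ) := by
  refine Finite.of_injective
    (fun T : BoundedSSYT p μ => fun c : μ.cells =>
      (⟨T.1 c.1.1 c.1.2, T.2 c.1 c.2⟩ : Fin p)) ?_
  intro T T' h
  refine Subtype.ext (SemistandardYoungTableau.ext fun i j => ?_)
  by_cases hc : (i, j) ∈ μ
  · exact congrArg Fin.val (congrFun h ⟨(i, j), hc⟩)
  · rw [T.1.zeros hc, T'.1.zeros hc]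

noncomputable instance BoundedSSYT.instFintype (p : ℕ) (μ : YoungDiagram) :
    Fintype (BoundedSSYT p μ) := Fintype.ofFinite _

/-- The Schur function `s_μ(x_1, …, x_p)`, the sum over all semistandard Young tableaux `T` of
shape `μ` with entries in `1, …, p` of the monomials `x^T`. The variable `x_{i+1}` is `x i`. -/
noncomputable def schur {R : Type*} [CommSemiring R] {p : ℕ} (μ : YoungDiagram)
    (x : Fin p → R) : R :=
  ∑ T : BoundedSSYT p μ, ∏ c : μ.cells, x ⟨T.1 c.1.1 c.1.2, T.2 c.1 c.2⟩

/-- The shifted diagram with `r` rows of lengths `lam 0, lam 1, …`: row `i` starts one box to the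
right of the start of row `i - 1`. -/
def shiftedDiagram {r : ℕ} (lam : Fin r → ℕ) : Finset (ℕ × ℕ) :=
  Finset.univ.biUnion fun i : Fin r => {(i : ℕ)} ×ˢ Finset.Ico (i : ℕ) (i + lam i)

/-- A filling of `D` by the numbers `1, …, |D|` (here shifted down by one), each used exactly
once, is standard if it increases across rows and down columns. -/
def IsStandardFilling {D : Finset (ℕ × ℕ)} (T : D ≃ Fin D.card) : Prop :=
  (∀ c d : D, c.1.1 = d.1.1 → c.1.2 < d.1.2 → T c < T d) ∧
    ∀ c d : D, c.1.2 = d.1.2 → c.1.1 < d.1.1 → T c < T d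

/-- The number `g_lam` of standard Young tableaux of shifted shape `lam`. -/
noncomputable def numShiftedSYT {r : ℕ} (lam : Fin r → ℕ) : ℕ :=
  Nat.card {T : shiftedDiagram lam ≃ Fin (shiftedDiagram lam).card // IsStandardFilling T}

/-- The factorial `x! = Γ(x + 1)` of a real number `x > -1`. -/
noncomputable def realFactorial (x : ℝ) : ℝ := Real.Gamma (x + 1)

/-- The product defining `E_1(r, p, s)` for even `r`. -/
noncomputable def evenE1 (r p : ℕ) (s : ℝ) : ℝ :=
  (∏ l ∈ Finset.Ioo r (2 * p + 2 - r), 1 / ((l : ℝ) + 2 * s) ^ (r / 2)) *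
    ∏ l ∈ Finset.Icc 2 r,
      1 / (((l : ℝ) + 2 * s) * (2 * (p : ℝ) - (l : ℝ) + 2 + 2 * s)) ^ (l / 2)

/-- The quantity `E_1(r, p, s)`, for `r ≤ p`. -/
noncomputable def E1 (r p : ℕ) (s : ℝ) : ℝ :=
  if Even r then evenE1 r p s
  else realFactorial (((r : ℝ) - 1) / 2 + s) / realFactorial ((p : ℝ) - ((r : ℝ) - 1) / 2 + s) *
    evenE1 (r - 1) p s

/-! The proof evaluates the sum in closed form, passes to the limit, determines the dependence on
`s` by a Liouville argument, and fixes the constant at `s = 0` combinatorially.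

Closed form. Summing over partitions with at most `r` parts gives `boundedSum`: a sum over
`r`-subsets `A` of the variables of Littlewood's product over `A` times `∏ x_a / (x_a - x_b)` with
`a ∈ A`, `b ∉ A` (`hasSum_schur`). Both sides obey the same two recursions. Deleting one variable
comes from expanding the bialternant along a column of ones. When there are as many variables as
allowed parts, full columns are stripped off. The identities needed on the closed side are Lagrange
interpolations evaluated at `0`.

Limit. For `x_i = q^(i+s)` every factor is some `(1 - q^c)⁻¹`, and each term has exactly `N` of
them, so the limit is an explicit rational function `limitSum` of `s`.

Dependence on `s`. The poles of each term lie at `s = -l/2`, with order at most `poleOrder`, so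
`limitSum * denomE1` is a polynomial in `s`. Monotonicity of Schur functions compares the parameter
`s` with the parameter `0` at another base `q^c`, giving `limitSum = O((1+s)^(-N))`; since `denomE1`
has degree `N`, the polynomial is bounded on `s ≥ 0`, hence constant (`limitSum_mul_denomE1_eq`). As
`E1 * denomE1` is also constant, `limitSum` is proportional to `E1`.

Value at `s = 0`. Tableaux with at most `r` rows correspond to plane partitions on the shifted
staircase (`tableauFilling`), with the variables `q, …, q^p` recording their size. Sorting the cells
by value bounds the generating function of plane partitions above and below by the number of
standard fillings times `∏ (1 - q^k)⁻¹`, up to a power of `q`, so the limit is `g / N!`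
(`tendsto_tsum_planePartition`). -/

/-! ### Young diagrams through their row lengths -/

/-- The Young diagram with rows of lengths `f 0, f 1, …, f (r - 1)`. -/
def YoungDiagram.ofAntitone (r : ℕ) (f : ℕ → ℕ) (hf : Antitone f) : YoungDiagram where
  cells := (Finset.range r ×ˢ Finset.range (f 0)).filter fun c => c.2 < f c.1
  isLowerSet := by
    rintro ⟨i, k⟩ ⟨i', k'⟩ h hm
    have h1 : i' ≤ i := h.1
    have h2 : k' ≤ k := h.2
    simp only [Finset.coe_filter, Finset.mem_product, Finset.mem_range, Set.mem_ofPred_eq] at hm ⊢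
    have := hf h1
    omega

theorem YoungDiagram.mem_ofAntitone {r : ℕ} {f : ℕ → ℕ} {hf : Antitone f} {i k : ℕ} :
    (i, k) ∈ YoungDiagram.ofAntitone r f hf ↔ i < r ∧ k < f i := by
  rw [← YoungDiagram.mem_cells]
  simp only [YoungDiagram.ofAntitone, Finset.mem_filter, Finset.mem_product, Finset.mem_range]
  have := hf (Nat.zero_le i)
  omega

theorem YoungDiagram.rowLen_ofAntitone {r : ℕ} {f : ℕ → ℕ} {hf : Antitone f} {i : ℕ} (hi : i < r) :
    (YoungDiagram.ofAntitone r f hf).rowLen i = f i := by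
  refine eq_of_forall_lt_iff fun k => ?_
  rw [← YoungDiagram.mem_iff_lt_rowLen, YoungDiagram.mem_ofAntitone]
  simp [hi]

theorem YoungDiagram.colLen_zero_le_iff {μ : YoungDiagram} {r : ℕ} :
    μ.colLen 0 ≤ r ↔ ∀ i k, (i, k) ∈ μ → i < r := by
  constructor
  · intro h i k hm
    have := YoungDiagram.mem_iff_lt_colLen.1 (μ.up_left_mem le_rfl (Nat.zero_le k) hm)
    omega
  · intro h
    by_contra! hlt
    exact lt_irrefl _ (h _ _ (YoungDiagram.mem_iff_lt_colLen.2 hlt))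

theorem YoungDiagram.rowLen_eq_zero {μ : YoungDiagram} {r i : ℕ} (h : μ.colLen 0 ≤ r)
    (hi : r ≤ i) : μ.rowLen i = 0 := by
  by_contra hne
  have := YoungDiagram.colLen_zero_le_iff.1 h i 0
    (YoungDiagram.mem_iff_lt_rowLen.2 (Nat.pos_of_ne_zero hne))
  omega

theorem YoungDiagram.ext_rowLen {μ ν : YoungDiagram} {r : ℕ} (hμ : μ.colLen 0 ≤ r)
    (hν : ν.colLen 0 ≤ r) (h : ∀ i < r, μ.rowLen i = ν.rowLen i) : μ = ν := by
  ext ⟨i, k⟩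
  rw [YoungDiagram.mem_cells, YoungDiagram.mem_cells, YoungDiagram.mem_iff_lt_rowLen,
    YoungDiagram.mem_iff_lt_rowLen]
  rcases lt_or_ge i r with hi | hi
  · rw [h i hi]
  · rw [YoungDiagram.rowLen_eq_zero hμ hi, YoungDiagram.rowLen_eq_zero hν hi]

theorem YoungDiagram.card_eq_sum_rowLen {μ : YoungDiagram} {r : ℕ} (hμ : μ.colLen 0 ≤ r) :
    μ.card = ∑ i : Fin r, μ.rowLen i := by
  rw [Finset.sum_fin_eq_sum_range, YoungDiagram.card,
    Finset.card_eq_sum_card_fiberwise (f := Prod.fst) (t := Finset.range r)]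
  · refine Finset.sum_congr rfl fun i hi => ?_
    rw [dif_pos (Finset.mem_range.1 hi), YoungDiagram.rowLen_eq_card]
    rfl
  · rintro ⟨i, k⟩ h
    exact Finset.mem_coe.2 (Finset.mem_range.2 (YoungDiagram.colLen_zero_le_iff.1 hμ i k h))

/-! ### Branching of tableaux at the largest letter -/

/-- A family indexed by `Fin p`, extended by `1` to all natural numbers. -/
def extendOne {R : Type*} [One R] {p : ℕ} (x : Fin p → R) (n : ℕ) : R :=
  if h : n < p then x ⟨n, h⟩ else 1

theorem extendOne_of_lt {R : Type*} [One R] {p : ℕ} (x : Fin p → R) {n : ℕ} (h : n < p) :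
    extendOne x n = x ⟨n, h⟩ := dif_pos h

theorem schur_eq_sum {R : Type*} [CommSemiring R] {p : ℕ} (μ : YoungDiagram) (x : Fin p → R) :
    schur μ x = ∑ T : BoundedSSYT p μ, ∏ c ∈ μ.cells, extendOne x (T.1 c.1 c.2) := by
  refine Finset.sum_congr rfl fun T _ => ?_
  rw [← Finset.prod_coe_sort μ.cells fun c => extendOne x (T.1 c.1 c.2)]
  exact Finset.prod_congr rfl fun c _ => (extendOne_of_lt x _).symm

theorem SemistandardYoungTableau.add_le {μ : YoungDiagram} (T : SemistandardYoungTableau μ)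
    {i k : ℕ} (d : ℕ) (h : (i + d, k) ∈ μ) : T i k + d ≤ T (i + d) k := by
  induction d with
  | zero => simp
  | succ d ih =>
    have h1 := ih (μ.up_left_mem (by omega) le_rfl h)
    have h2 := T.col_strict (i1 := i + d) (i2 := i + (d + 1)) (by omega) h
    omega

theorem SemistandardYoungTableau.le_apply {μ : YoungDiagram} (T : SemistandardYoungTableau μ)
    {i k : ℕ} (h : (i, k) ∈ μ) : i ≤ T i k := by
  have := T.add_le (i := 0) (k := k) i (by simpa using h)
  simp only [Nat.zero_add] at this
  omega

/-- The part of the shape of `T` occupied by entries smaller than `t`. -/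
def SemistandardYoungTableau.below {μ : YoungDiagram} (T : SemistandardYoungTableau μ) (t : ℕ) :
    YoungDiagram where
  cells := μ.cells.filter fun c => T c.1 c.2 < t
  isLowerSet := by
    rintro ⟨i, k⟩ ⟨i', k'⟩ h hm
    have h1 : i' ≤ i := h.1
    have h2 : k' ≤ k := h.2
    simp only [Finset.coe_filter, Set.mem_ofPred_eq, YoungDiagram.mem_cells] at hm ⊢
    refine ⟨μ.up_left_mem h1 h2 hm.1, ?_⟩
    have a := T.col_weak h1 (μ.up_left_mem le_rfl h2 hm.1)
    have b := T.row_weak_of_le h2 hm.1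
    omega

theorem SemistandardYoungTableau.mem_below {μ : YoungDiagram} {T : SemistandardYoungTableau μ}
    {t i k : ℕ} : (i, k) ∈ T.below t ↔ (i, k) ∈ μ ∧ T i k < t := by
  rw [← YoungDiagram.mem_cells]
  simp [SemistandardYoungTableau.below]

/-- The part of the shape of `T` occupied by entries other than the largest letter. -/
abbrev BoundedSSYT.initShape {p : ℕ} {μ : YoungDiagram} (T : BoundedSSYT (p + 1) μ) :
    YoungDiagram :=
  T.1.below p

theorem BoundedSSYT.mem_initShape {p : ℕ} {μ : YoungDiagram} {T : BoundedSSYT (p + 1) μ}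
    {i k : ℕ} : (i, k) ∈ T.initShape ↔ (i, k) ∈ μ ∧ T.1 i k < p :=
  SemistandardYoungTableau.mem_below

/-- `ν` has at most `p` rows, and is obtained from `μ` by removing a horizontal strip. -/
def IsStrip (p : ℕ) (μ ν : YoungDiagram) : Prop :=
  ν ≤ μ ∧ (∀ i k, (i + 1, k) ∈ μ → (i, k) ∈ ν) ∧ ν.colLen 0 ≤ p

theorem finite_isStrip (p : ℕ) (μ : YoungDiagram) : {ν | IsStrip p μ ν}.Finite := by
  refine Set.Finite.of_finite_image (f := YoungDiagram.cells)
    (Set.Finite.subset (μ.cells.powerset.finite_toSet) ?_) ?_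
  · rintro _ ⟨ν, h, rfl⟩
    exact Finset.mem_coe.2 (Finset.mem_powerset.2 h.1)
  · intro ν _ ν' _ h
    exact YoungDiagram.ext h

theorem BoundedSSYT.isStrip_initShape {p : ℕ} {μ : YoungDiagram} (T : BoundedSSYT (p + 1) μ) :
    IsStrip p μ T.initShape := by
  refine ⟨fun c hc => (BoundedSSYT.mem_initShape.1 hc).1, fun i k h => ?_, ?_⟩
  · refine BoundedSSYT.mem_initShape.2 ⟨μ.up_left_mem (by omega) le_rfl h, ?_⟩
    have h1 := T.1.col_strict (lt_add_one i) h
    have h2 := T.2 _ h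
    simp only at h1 h2
    omega
  · refine YoungDiagram.colLen_zero_le_iff.2 fun i k h => ?_
    have h := BoundedSSYT.mem_initShape.1 h
    have := T.1.le_apply h.1
    omega

/-- Restriction of `T` to the cells not holding the largest letter. -/
def BoundedSSYT.init {p : ℕ} {μ ν : YoungDiagram} (T : BoundedSSYT (p + 1) μ)
    (h : T.initShape = ν) : BoundedSSYT p ν :=
  ⟨{ entry := fun i k => if (i, k) ∈ ν then T.1 i k else 0
     row_weak' := by
      intro i k k' hk hm
      rw [if_pos hm, if_pos (ν.up_left_mem le_rfl hk.le hm)]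
      subst h
      exact T.1.row_weak hk (BoundedSSYT.mem_initShape.1 hm).1
     col_strict' := by
      intro i i' k hi hm
      rw [if_pos hm, if_pos (ν.up_left_mem hi.le le_rfl hm)]
      subst h
      exact T.1.col_strict hi (BoundedSSYT.mem_initShape.1 hm).1
     zeros' := fun hm => if_neg hm }, by
    rintro ⟨i, k⟩ hm
    change (if (i, k) ∈ ν then T.1 i k else 0) < p
    have hm : (i, k) ∈ ν := hm
    rw [if_pos hm]
    subst h
    exact (BoundedSSYT.mem_initShape.1 hm).2⟩

theorem BoundedSSYT.init_apply {p : ℕ} {μ ν : YoungDiagram} (T : BoundedSSYT (p + 1) μ)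
    (h : T.initShape = ν) (i k : ℕ) :
    (T.init h).1 i k = if (i, k) ∈ ν then T.1 i k else 0 := rfl

/-- Extension of a tableau by a horizontal strip of cells holding the new largest letter. -/
def BoundedSSYT.snoc {p : ℕ} {μ ν : YoungDiagram} (T : BoundedSSYT p ν) (h : IsStrip p μ ν) :
    BoundedSSYT (p + 1) μ :=
  ⟨{ entry := fun i k => if (i, k) ∈ ν then T.1 i k else if (i, k) ∈ μ then p else 0
     row_weak' := by
      intro i k k' hk hm
      by_cases hν : (i, k') ∈ ν
      · rw [if_pos hν, if_pos (ν.up_left_mem le_rfl hk.le hν)]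
        exact T.1.row_weak hk hν
      · rw [if_neg hν, if_pos hm, if_pos (μ.up_left_mem le_rfl hk.le hm)]
        split_ifs with h1
        · exact (T.2 _ h1).le
        · exact le_rfl
     col_strict' := by
      intro i i' k hi hm
      have hi1 : (i, k) ∈ ν := h.2.1 i k (μ.up_left_mem hi le_rfl hm)
      rw [if_pos hi1, if_pos hm]
      split_ifs with h1
      · exact T.1.col_strict hi h1
      · exact T.2 _ hi1
     zeros' := by
      intro i k hm
      rw [if_neg (fun h1 => hm (h.1 h1)), if_neg hm] }, by
    rintro ⟨i, k⟩ hm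
    change (if (i, k) ∈ ν then T.1 i k else if (i, k) ∈ μ then p else 0) < p + 1
    split_ifs with h1
    · exact (T.2 _ h1).trans (Nat.lt_succ_self p)
    · exact Nat.lt_succ_self p
    · exact Nat.succ_pos p⟩

theorem BoundedSSYT.snoc_apply {p : ℕ} {μ ν : YoungDiagram} (T : BoundedSSYT p ν)
    (h : IsStrip p μ ν) (i k : ℕ) :
    (T.snoc h).1 i k = if (i, k) ∈ ν then T.1 i k else if (i, k) ∈ μ then p else 0 := rfl

theorem BoundedSSYT.ext_entry {p : ℕ} {μ : YoungDiagram} {T T' : BoundedSSYT p μ}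
    (h : ∀ i k, (i, k) ∈ μ → T.1 i k = T'.1 i k) : T = T' := by
  refine Subtype.ext (SemistandardYoungTableau.ext fun i k => ?_)
  by_cases hm : (i, k) ∈ μ
  · exact h i k hm
  · rw [T.1.zeros hm, T'.1.zeros hm]

theorem BoundedSSYT.initShape_snoc {p : ℕ} {μ ν : YoungDiagram} (T : BoundedSSYT p ν)
    (h : IsStrip p μ ν) : (T.snoc h).initShape = ν := by
  ext ⟨i, k⟩
  rw [YoungDiagram.mem_cells, YoungDiagram.mem_cells, BoundedSSYT.mem_initShape,
    BoundedSSYT.snoc_apply]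
  constructor
  · rintro ⟨h1, h2⟩
    by_contra hν
    rw [if_neg hν, if_pos h1] at h2
    exact lt_irrefl _ h2
  · intro hν
    rw [if_pos hν]
    exact ⟨h.1 hν, T.2 _ hν⟩

/-- The cells holding the largest letter form a horizontal strip, so tableaux can be grouped by the
shape left when that strip is removed. -/
theorem schur_succ {R : Type*} [CommSemiring R] {p : ℕ} (μ : YoungDiagram) (x : Fin (p + 1) → R) :
    schur μ x = ∑ ν ∈ (finite_isStrip p μ).toFinset,
      schur ν (fun i : Fin p => x i.castSucc) * x (Fin.last p) ^ (μ.card - ν.card) := by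
  classical
  rw [schur_eq_sum, ← Finset.sum_fiberwise_of_maps_to
    (g := fun T : BoundedSSYT (p + 1) μ => T.initShape)
    (t := (finite_isStrip p μ).toFinset)
    (fun T _ => (finite_isStrip p μ).mem_toFinset.2 T.isStrip_initShape)]
  refine Finset.sum_congr rfl fun ν hν => ?_
  have hν : IsStrip p μ ν := (finite_isStrip p μ).mem_toFinset.1 hν
  rw [schur_eq_sum, Finset.sum_mul]
  refine Finset.sum_bij (fun T hT => T.init (Finset.mem_filter.1 hT).2)
    (fun _ _ => Finset.mem_univ _) ?_ ?_ ?_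
  · intro T hT T' hT' h
    refine BoundedSSYT.ext_entry fun i k hm => ?_
    have e1 := (Finset.mem_filter.1 hT).2
    have e2 := (Finset.mem_filter.1 hT').2
    by_cases hn : (i, k) ∈ ν
    · have := congrArg (fun U : BoundedSSYT p ν => U.1 i k) h
      simpa only [BoundedSSYT.init_apply, if_pos hn] using this
    · have a1 : ¬ T.1 i k < p := fun h => hn (e1 ▸ BoundedSSYT.mem_initShape.2 ⟨hm, h⟩)
      have a2 : ¬ T'.1 i k < p := fun h => hn (e2 ▸ BoundedSSYT.mem_initShape.2 ⟨hm, h⟩)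
      have b1 := T.2 _ hm
      have b2 := T'.2 _ hm
      simp only at b1 b2
      omega
  · intro U _
    refine ⟨U.snoc hν, Finset.mem_filter.2 ⟨Finset.mem_univ _, U.initShape_snoc hν⟩, ?_⟩
    refine BoundedSSYT.ext_entry fun i k hm => ?_
    rw [BoundedSSYT.init_apply, if_pos hm, BoundedSSYT.snoc_apply, if_pos hm]
  · intro T hT
    have e := (Finset.mem_filter.1 hT).2
    rw [← Finset.prod_sdiff (show ν.cells ⊆ μ.cells from hν.1), mul_comm]
    congr 1
    · refine Finset.prod_congr rfl fun c hc => ?_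
      have hc' : (c.1, c.2) ∈ ν := hc
      have hlt : T.1 c.1 c.2 < p := by
        rw [← e] at hc'
        exact (BoundedSSYT.mem_initShape.1 hc').2
      rw [BoundedSSYT.init_apply, if_pos hc', extendOne_of_lt _ (hlt.trans (Nat.lt_succ_self p)),
        extendOne_of_lt _ hlt]
      rfl
    · rw [YoungDiagram.card, YoungDiagram.card,
        ← Finset.card_sdiff_of_subset (show ν.cells ⊆ μ.cells from hν.1)]
      refine Finset.prod_eq_pow_card fun c hc => ?_
      have hc := Finset.mem_sdiff.1 hc
      have a1 : ¬ T.1 c.1 c.2 < p := fun h =>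
        hc.2 (show (c.1, c.2) ∈ ν from e ▸ BoundedSSYT.mem_initShape.2 ⟨hc.1, h⟩)
      have b1 := T.2 _ hc.1
      have : T.1 c.1 c.2 = p := by omega
      rw [this, extendOne_of_lt _ (Nat.lt_succ_self p)]
      rfl

/-! ### Alternants and the bialternant formula -/

/-- The alternant `det (x_i ^ (E_j))`. -/
def alternant {R : Type*} [CommRing R] {p : ℕ} (E : Fin p → ℕ) (x : Fin p → R) : R :=
  (Matrix.of fun i j => x i ^ E j).det

/-- Subtracting from each column a power of the last variable `y` times its predecessor clears the
last row except its first entry. Each remaining row is divisible by `x_i - y`, and the quotients are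
geometric sums, which multilinearity in the columns expands. The exponents `m` interlace with `E`,
as a horizontal strip does with its shape. -/
theorem alternant_succ {R : Type*} [CommRing R] {p : ℕ} (E : Fin (p + 1) → ℕ)
    (hE : ∀ j : Fin p, E j.castSucc ≤ E j.succ) (x : Fin (p + 1) → R) :
    alternant E x = x (Fin.last p) ^ E 0 * (∏ i : Fin p, (x (Fin.last p) - x i.castSucc)) *
      ∑ m ∈ Fintype.piFinset fun j : Fin p => Finset.Ico (E j.castSucc) (E j.succ),
        (∏ j, x (Fin.last p) ^ (E j.succ - 1 - m j)) *
          alternant m (fun i : Fin p => x i.castSucc) := by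
  set y := x (Fin.last p) with hy
  let B : Matrix (Fin (p + 1)) (Fin (p + 1)) R := Matrix.of fun i j =>
    Fin.cases (motive := fun _ => R) (x i ^ E 0)
      (fun j' => x i ^ E j'.succ - y ^ (E j'.succ - E j'.castSucc) * x i ^ E j'.castSucc) j
  have h1 : alternant E x = B.det := by
    refine Matrix.det_eq_of_forall_col_eq_smul_add_pred
      (fun j' => y ^ (E j'.succ - E j'.castSucc)) (fun i => rfl) fun i j => ?_
    change x i ^ E j.succ = x i ^ E j.succ - _ + _
    simp only [Matrix.of_apply]
    ring
  have hlast : ∀ j : Fin p, B (Fin.last p) j.succ = 0 := by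
    intro j
    change y ^ E j.succ - y ^ (E j.succ - E j.castSucc) * y ^ E j.castSucc = 0
    rw [← pow_add, Nat.sub_add_cancel (hE j), sub_self]
  have h2 : B.det = (-1) ^ p * y ^ E 0 *
      (B.submatrix Fin.castSucc Fin.succ).det := by
    rw [Matrix.det_succ_row B (Fin.last p), Fin.sum_univ_succ]
    rw [Finset.sum_eq_zero (fun j _ => by rw [hlast]; ring), add_zero]
    have : (Fin.last p).succAbove = Fin.castSucc := Fin.succAbove_last
    rw [this, Fin.val_last, Fin.val_zero, add_zero]
    rfl
  have h3 : (B.submatrix Fin.castSucc Fin.succ).det =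
      (∏ i : Fin p, (x i.castSucc - y)) * (Matrix.of fun i j : Fin p =>
        ∑ m ∈ Finset.Ico (E j.castSucc) (E j.succ),
          x i.castSucc ^ m * y ^ (E j.succ - 1 - m)).det := by
    rw [← Matrix.det_mul_column]
    congr 1
    ext i j
    simp only [Matrix.of_apply, Matrix.submatrix_apply]
    rw [(Commute.all (x i.castSucc) y).mul_geom_sum₂_Ico (hE j), mul_comm (_ ^ E j.castSucc)]
    rfl
  have h4 : (Matrix.of fun i j : Fin p =>
        ∑ m ∈ Finset.Ico (E j.castSucc) (E j.succ),
          x i.castSucc ^ m * y ^ (E j.succ - 1 - m)).det =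
      ∑ m ∈ Fintype.piFinset fun j : Fin p => Finset.Ico (E j.castSucc) (E j.succ),
        (∏ j, y ^ (E j.succ - 1 - m j)) * alternant m (fun i : Fin p => x i.castSucc) := by
    rw [← Matrix.det_transpose]
    have := (Matrix.detRowAlternating (n := Fin p) (R := R)).toMultilinearMap.map_sum_finset
      (fun j m => fun i : Fin p => x i.castSucc ^ m * y ^ (E j.succ - 1 - m))
      (fun j => Finset.Ico (E j.castSucc) (E j.succ))
    refine Eq.trans ?_ (this.trans ?_)
    · change Matrix.det _ = Matrix.det _
      congr 1
      ext i j
      simp [Matrix.transpose_apply, Finset.sum_apply]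
    · refine Finset.sum_congr rfl fun m _ => ?_
      rw [alternant, ← Matrix.det_transpose, ← Matrix.det_mul_column]
      change Matrix.det _ = Matrix.det _
      congr 1
      ext i j
      simp [Matrix.transpose_apply, mul_comm]
  rw [h1, h2, h3, h4]
  have h5 : ∏ i : Fin p, (y - x i.castSucc) = (-1) ^ p * ∏ i : Fin p, (x i.castSucc - y) := by
    have : ∏ i : Fin p, (y - x i.castSucc) = ∏ i : Fin p, (-1) * (x i.castSucc - y) :=
      Finset.prod_congr rfl fun i _ => by ring
    rw [this, Finset.prod_mul_distrib, Finset.prod_const, Finset.card_univ, Fintype.card_fin]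
  rw [h5]
  ring

/-- The Vandermonde determinant `∏_{i<j} (x_j - x_i)`. -/
abbrev vdm {R : Type*} [CommRing R] {p : ℕ} (x : Fin p → R) : R := (Matrix.vandermonde x).det

theorem vdm_succ {R : Type*} [CommRing R] {p : ℕ} (x : Fin (p + 1) → R) :
    vdm x = (∏ i : Fin p, (x (Fin.last p) - x i.castSucc)) *
      vdm (fun i : Fin p => x i.castSucc) := by
  have h := alternant_succ (fun j : Fin (p + 1) => (j : ℕ)) (fun j => by simp) x
  have h1 : (fun j : Fin p => Finset.Ico ((j.castSucc : Fin (p + 1)) : ℕ) (j.succ : Fin (p + 1))) =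
      fun j : Fin p => {(j : ℕ)} := by
    funext j
    simp
  rw [h1, Fintype.piFinset_singleton, Finset.sum_singleton] at h
  change alternant (fun j : Fin (p + 1) => (j : ℕ)) x =
    _ * alternant (fun j : Fin p => (j : ℕ)) _
  simpa using h

/-- Induction on the number of variables: `schur_succ` and `alternant_succ` are the same recursion
once a strip `ν` is encoded by its exponents `ν.rowLen j.rev + j`. The reversal makes the exponents
increase with `j`. -/
theorem schur_mul_vdm {R : Type*} [CommRing R] {p : ℕ} (μ : YoungDiagram) (hμ : μ.colLen 0 ≤ p)
    (x : Fin p → R) :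
    schur μ x * vdm x = alternant (fun j : Fin p => μ.rowLen j.rev + j) x := by
  induction p generalizing μ with
  | zero =>
    have hbot : μ.cells = ∅ := by
      refine Finset.eq_empty_of_forall_notMem fun c hc => ?_
      exact absurd (YoungDiagram.colLen_zero_le_iff.1 hμ c.1 c.2 hc) (Nat.not_lt_zero _)
    have hu : Unique (BoundedSSYT 0 μ) :=
      { default := ⟨SemistandardYoungTableau.highestWeight μ, by simp [hbot]⟩
        uniq := fun T => BoundedSSYT.ext_entry fun i k hm =>
          absurd (YoungDiagram.colLen_zero_le_iff.1 hμ i k hm) (Nat.not_lt_zero _) }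
    have h1 : schur μ x = 1 := by
      rw [schur_eq_sum, Fintype.sum_unique]
      exact Finset.prod_eq_one fun c hc => absurd (hbot ▸ hc) (Finset.notMem_empty c)
    rw [h1]
    simp [vdm, alternant]
  | succ p ih =>
    have hE : ∀ j : Fin p, μ.rowLen j.castSucc.rev + (j.castSucc : ℕ) ≤
        μ.rowLen j.succ.rev + (j.succ : ℕ) := by
      intro j
      have := μ.rowLen_anti j.succ.rev j.castSucc.rev (by
        rw [Fin.val_rev, Fin.val_rev, Fin.val_succ, Fin.val_castSucc]
        omega)
      simp only [Fin.val_castSucc, Fin.val_succ]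
      omega
    rw [schur_succ, vdm_succ, alternant_succ _ hE, Finset.sum_mul, Finset.mul_sum]
    refine Finset.sum_bij (fun ν _ => fun j : Fin p => ν.rowLen j.rev + j) ?_ ?_ ?_ ?_
    · intro ν hν
      have hν : IsStrip p μ ν := (finite_isStrip p μ).mem_toFinset.1 hν
      refine Fintype.mem_piFinset.2 fun j => Finset.mem_Ico.2 ⟨?_, ?_⟩
      · have : μ.rowLen j.castSucc.rev ≤ ν.rowLen j.rev := by
          refine le_of_forall_lt fun k hk => ?_
          refine YoungDiagram.mem_iff_lt_rowLen.1 (hν.2.1 _ _ ?_)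
          rw [YoungDiagram.mem_iff_lt_rowLen]
          simpa [Fin.rev_castSucc] using hk
        simp only [Fin.val_castSucc]
        omega
      · have : ν.rowLen j.rev ≤ μ.rowLen j.succ.rev := by
          refine le_of_forall_lt fun k hk => ?_
          have := hν.1 (YoungDiagram.mem_iff_lt_rowLen.2 hk)
          rw [YoungDiagram.mem_iff_lt_rowLen] at this
          simpa [Fin.rev_succ] using this
        simp only [Fin.val_succ]
        omega
    · intro ν hν ν' hν' h
      have hν : IsStrip p μ ν := (finite_isStrip p μ).mem_toFinset.1 hν
      have hν' : IsStrip p μ ν' := (finite_isStrip p μ).mem_toFinset.1 hν'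
      refine YoungDiagram.ext_rowLen hν.2.2 hν'.2.2 fun i hi => ?_
      have := congrFun h (Fin.rev ⟨i, hi⟩)
      simpa using this
    · intro m hm
      -- The interlacing bounds on `m`, rewritten by row index; they say that the shape rebuilt from
      -- `m` differs from `μ` by a horizontal strip.
      have hm' : ∀ i : ℕ, ∀ hi : i < p,
          μ.rowLen (i + 1) + (p - 1 - i) ≤ m (Fin.rev ⟨i, hi⟩) ∧
            m (Fin.rev ⟨i, hi⟩) ≤ μ.rowLen i + (p - 1 - i) := by
        intro i hi
        have := Finset.mem_Ico.1 (Fintype.mem_piFinset.1 hm (Fin.rev ⟨i, hi⟩))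
        simp only [Fin.rev_castSucc, Fin.rev_succ, Fin.rev_rev, Fin.val_succ, Fin.val_castSucc,
          Fin.val_rev] at this
        omega
      let f : ℕ → ℕ := fun i => if hi : i < p then m (Fin.rev ⟨i, hi⟩) - (p - 1 - i) else 0
      have hf0 : ∀ i, (hi : i < p) → f i = m (Fin.rev ⟨i, hi⟩) - (p - 1 - i) :=
        fun i hi => dif_pos hi
      have hf : Antitone f := by
        refine antitone_nat_of_succ_le fun i => ?_
        by_cases hi : i + 1 < p
        · have a := hm' i (by omega)
          have b := hm' (i + 1) hi
          rw [hf0 i (by omega), hf0 (i + 1) hi]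
          omega
        · simp [f, hi]
      have hrow : ∀ i < p, (YoungDiagram.ofAntitone p f hf).rowLen i = f i :=
        fun i hi => YoungDiagram.rowLen_ofAntitone hi
      refine ⟨YoungDiagram.ofAntitone p f hf, (finite_isStrip p μ).mem_toFinset.2
        ⟨?_, ?_, ?_⟩, ?_⟩
      · rintro ⟨i, k⟩ hc
        obtain ⟨hi, hk⟩ := YoungDiagram.mem_ofAntitone.1 hc
        rw [hf0 i hi] at hk
        have := hm' i hi
        refine YoungDiagram.mem_iff_lt_rowLen.2 ?_
        omega
      · intro i k hc
        have hi := YoungDiagram.colLen_zero_le_iff.1 hμ _ _ hc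
        rw [YoungDiagram.mem_iff_lt_rowLen] at hc
        have hi : i < p := by omega
        refine YoungDiagram.mem_ofAntitone.2 ⟨hi, ?_⟩
        rw [hf0 i hi]
        have := hm' i hi
        omega
      · exact YoungDiagram.colLen_zero_le_iff.2 fun i k hc => (YoungDiagram.mem_ofAntitone.1 hc).1
      · funext j
        rw [hrow _ j.rev.2, hf0 _ j.rev.2]
        have := hm' j.rev j.rev.2
        have e : Fin.rev ⟨(j.rev : ℕ), j.rev.2⟩ = j := Fin.rev_rev j
        rw [e] at this ⊢
        simp only [Fin.val_rev] at this ⊢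
        omega
    · intro ν hν
      have hν : IsStrip p μ ν := (finite_isStrip p μ).mem_toFinset.1 hν
      rw [← ih ν hν.2.2]
      have hle : ∀ j : Fin p, ν.rowLen j.rev ≤ μ.rowLen j.rev := by
        intro j
        refine le_of_forall_lt fun k hk => ?_
        exact YoungDiagram.mem_iff_lt_rowLen.1 (hν.1 (YoungDiagram.mem_iff_lt_rowLen.2 hk))
      have hcard : μ.card - ν.card = μ.rowLen p + ∑ j : Fin p, (μ.rowLen j.rev - ν.rowLen j.rev) := by
        have a : μ.card = μ.rowLen p + ∑ j : Fin p, μ.rowLen j.rev := by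
          rw [YoungDiagram.card_eq_sum_rowLen hμ, Fin.sum_univ_castSucc, add_comm]
          congr 1
          exact (Equiv.sum_comp Fin.revPerm fun j : Fin p => μ.rowLen j).symm
        have b : ν.card = ∑ j : Fin p, ν.rowLen j.rev := by
          rw [YoungDiagram.card_eq_sum_rowLen hν.2.2]
          exact (Equiv.sum_comp Fin.revPerm fun j : Fin p => ν.rowLen j).symm
        have c := Finset.sum_le_sum fun j (_ : j ∈ Finset.univ) => hle j
        rw [a, b, Finset.sum_tsub_distrib _ (fun j _ => hle j)]
        omega
      rw [hcard, pow_add, ← Finset.prod_pow_eq_pow_sum]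
      have hexp : ∀ j : Fin p, μ.rowLen j.succ.rev + (j.succ : ℕ) - 1 - (ν.rowLen j.rev + (j : ℕ)) =
          μ.rowLen j.rev - ν.rowLen j.rev := by
        intro j
        simp only [Fin.rev_succ, Fin.val_succ, Fin.val_castSucc]
        omega
      simp only [hexp, Fin.rev_zero, Fin.val_last, Fin.val_zero, add_zero]
      ring

theorem vdm_eq_succAbove {R : Type*} [CommRing R] {p : ℕ} (x : Fin (p + 1) → R)
    (b : Fin (p + 1)) :
    vdm x = (-1) ^ (b : ℕ) * (∏ a : Fin p, (x (b.succAbove a) - x b)) *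
      vdm (fun a : Fin p => x (b.succAbove a)) := by
  have h1 : vdm (fun i => x (b.cycleRange.symm i)) = (-1) ^ (b : ℕ) * vdm x := by
    have := Matrix.det_permute b.cycleRange.symm (Matrix.vandermonde x)
    rw [Equiv.Perm.sign_symm, Fin.sign_cycleRange] at this
    refine Eq.trans (b := ((Matrix.vandermonde x).submatrix b.cycleRange.symm id).det) rfl ?_
    rw [this]
    simp
  have h2 : vdm (fun i => x (b.cycleRange.symm i)) =
      (∏ a : Fin p, (x (b.succAbove a) - x b)) * vdm (fun a : Fin p => x (b.succAbove a)) := by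
    rw [vdm, vdm, Matrix.det_vandermonde, Matrix.det_vandermonde, Fin.prod_univ_succ,
      Fin.prod_Ioi_zero]
    simp only [Fin.prod_Ioi_succ, Fin.cycleRange_symm_zero, Fin.cycleRange_symm_succ]
  rw [mul_assoc, ← h2, h1, ← mul_assoc, ← mul_pow]
  simp

theorem vdm_ne_zero {K : Type*} [Field K] {p : ℕ} {x : Fin p → K} (hx : Function.Injective x) :
    vdm x ≠ 0 :=
  Matrix.det_vandermonde_ne_zero_iff.2 hx

/-- With fewer parts than variables the smallest exponent of the alternant is `0`, so its first
column consists of ones; Laplace expansion along it leaves alternants in one variable fewer, each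
divided by its share of the Vandermonde product. -/
theorem schur_eq_sum_succAbove {K : Type*} [Field K] {p : ℕ} (μ : YoungDiagram)
    (hμ : μ.colLen 0 ≤ p) {x : Fin (p + 1) → K} (hx : Function.Injective x) :
    schur μ x = ∑ b : Fin (p + 1),
      (∏ a : Fin p, x (b.succAbove a) / (x (b.succAbove a) - x b)) *
        schur μ (fun a => x (b.succAbove a)) := by
  refine mul_right_cancel₀ (vdm_ne_zero hx) ?_
  rw [schur_mul_vdm μ (hμ.trans (Nat.le_succ p)), alternant, Matrix.det_succ_column_zero,
    Finset.sum_mul]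
  refine Finset.sum_congr rfl fun b _ => ?_
  have hne : ∏ a : Fin p, (x (b.succAbove a) - x b) ≠ 0 :=
    Finset.prod_ne_zero_iff.2 fun a _ => sub_ne_zero.2 fun h => Fin.succAbove_ne b a (hx h)
  have h1 : ((Matrix.of fun i j : Fin (p + 1) => x i ^ (μ.rowLen j.rev + (j : ℕ))).submatrix
      b.succAbove Fin.succ).det = (∏ a : Fin p, x (b.succAbove a)) *
        (schur μ (fun a => x (b.succAbove a)) * vdm fun a => x (b.succAbove a)) := by
    rw [schur_mul_vdm μ hμ, alternant, ← Matrix.det_mul_column]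
    congr 1
    ext i j
    simp only [Matrix.submatrix_apply, Matrix.of_apply, Fin.rev_succ, Fin.val_castSucc,
      Fin.val_succ]
    ring
  rw [h1, vdm_eq_succAbove x b, Finset.prod_div_distrib]
  have h0 : μ.rowLen ((0 : Fin (p + 1)).rev) = 0 :=
    YoungDiagram.rowLen_eq_zero hμ (by simp)
  simp only [Matrix.of_apply, h0, Fin.val_zero, add_zero, pow_zero, mul_one]
  field_simp

theorem schur_shift {K : Type*} [Field K] {p k : ℕ} {μ ν : YoungDiagram}
    (hμ : μ.colLen 0 ≤ p) (hν : ν.colLen 0 ≤ p) (h : ∀ i < p, ν.rowLen i = k + μ.rowLen i)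
    {x : Fin p → K} (hx : Function.Injective x) : schur ν x = (∏ i, x i) ^ k * schur μ x := by
  refine mul_right_cancel₀ (vdm_ne_zero hx) ?_
  rw [mul_assoc, schur_mul_vdm μ hμ, schur_mul_vdm ν hν, alternant, alternant, ← Finset.prod_pow,
    ← Matrix.det_mul_column]
  congr 1
  ext i j
  simp only [Matrix.of_apply]
  rw [h _ j.rev.2]
  ring

/-! ### Lagrange interpolation identities at the point zero -/

section Interpolation

variable {ι K : Type*} [Field K]

theorem eval_zero_lagrange_basis [DecidableEq ι] (Y : Finset ι) (x : ι → K) (b : ι) :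
    (Lagrange.basis Y x b).eval 0 = ∏ a ∈ Y.erase b, x a / (x a - x b) := by
  rw [Lagrange.basis, Polynomial.eval_prod]
  refine Finset.prod_congr rfl fun a _ => ?_
  simp only [Lagrange.basisDivisor, Polynomial.eval_mul, Polynomial.eval_C, Polynomial.eval_sub,
    Polynomial.eval_X]
  rw [← neg_sub (x a) (x b), inv_neg, div_eq_mul_inv]
  ring

theorem sum_prod_div_sub [DecidableEq ι] {Y : Finset ι} {x : ι → K} (hx : Set.InjOn x Y)
    (hY : Y.Nonempty) : ∑ b ∈ Y, ∏ a ∈ Y.erase b, x a / (x a - x b) = 1 := by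
  have := congrArg (Polynomial.eval 0) (Lagrange.sum_basis hx hY)
  rw [Polynomial.eval_finsetSum] at this
  simpa only [eval_zero_lagrange_basis, Polynomial.eval_one] using this

/-- Interpolate `G(z) = ∏ (1 - z x_a)` at the points `x_a` and at the extra node `-1`, and evaluate
at `0`. The extra node makes the degree small enough and contributes exactly `∏ x_a`. -/
theorem sum_prod_div_sub_mul_prod [DecidableEq ι] {A : Finset ι} {x : ι → K} (hx : Set.InjOn x A)
    (h1 : ∀ a ∈ A, 1 + x a ≠ 0) :
    ∑ i ∈ A, (∏ a ∈ A.erase i, x a / (x a - x i)) *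
      ((1 - x i) * ∏ a ∈ A.erase i, (1 - x i * x a)) = 1 - ∏ a ∈ A, x a := by
  let v : Option ι → K := fun o => o.elim (-1) x
  let G : Polynomial K := ∏ a ∈ A, (1 - Polynomial.C (x a) * Polynomial.X)
  have hG : ∀ z, G.eval z = ∏ a ∈ A, (1 - z * x a) := by
    intro z
    simp only [G, Polynomial.eval_prod]
    refine Finset.prod_congr rfl fun a _ => ?_
    simp only [Polynomial.eval_sub, Polynomial.eval_one, Polynomial.eval_mul, Polynomial.eval_C,
      Polynomial.eval_X, mul_comm]
  have hdeg : G.degree < (Finset.insertNone A).card := by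
    rw [Finset.card_insertNone]
    refine lt_of_le_of_lt (Polynomial.degree_prod_le _ _) ?_
    refine lt_of_le_of_lt (Finset.sum_le_sum (g := fun _ => (1 : WithBot ℕ)) fun a _ => ?_) ?_
    · compute_degree
    · simp only [Finset.sum_const, nsmul_eq_mul, mul_one]
      exact_mod_cast Nat.lt_succ_self _
  have hv : Set.InjOn v (Finset.insertNone A : Finset (Option ι)) := by
    intro o ho o' ho' h
    rcases o with _ | a <;> rcases o' with _ | a'
    · rfl
    · refine absurd ?_ (h1 a' (by simpa using ho'))
      have : -1 = x a' := h
      rw [← this]; ring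
    · refine absurd ?_ (h1 a (by simpa using ho))
      have : x a = -1 := h
      rw [this]; ring
    · exact congrArg some (hx (by simpa using ho) (by simpa using ho') h)
  have key := congrArg (Polynomial.eval 0) (Lagrange.eq_interpolate hv hdeg)
  rw [Lagrange.interpolate_apply, Polynomial.eval_finsetSum, hG] at key
  simp only [Polynomial.eval_mul, Polynomial.eval_C, eval_zero_lagrange_basis,
    Finset.sum_insertNone, hG] at key
  have e1 : (Finset.insertNone A).erase none = A.map Function.Embedding.some := by
    ext o; cases o <;> simp
  have e2 : ∀ i, (Finset.insertNone A).erase (some i) = Finset.insertNone (A.erase i) := by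
    intro i; ext o; cases o <;> simp
  rw [e1, Finset.prod_map] at key
  simp only [e2, Finset.prod_insertNone] at key
  have t0 : (∏ a ∈ A, (1 - v none * x a)) *
      ∏ a ∈ A, v (Function.Embedding.some a) / (v (Function.Embedding.some a) - v none) =
      ∏ a ∈ A, x a := by
    rw [← Finset.prod_mul_distrib]
    refine Finset.prod_congr rfl fun a ha => ?_
    have := h1 a ha
    change (1 - (-1) * x a) * (x a / (x a - (-1))) = x a
    rw [show (1 - (-1) * x a) = 1 + x a by ring, show x a - (-1) = 1 + x a by ring]
    field_simp
  rw [t0] at key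
  simp only [zero_mul, sub_zero, Finset.prod_const_one] at key
  refine eq_sub_of_add_eq' (Eq.trans ?_ key.symm)
  congr 1
  refine Finset.sum_congr rfl fun i hi => ?_
  rw [← Finset.mul_prod_erase A _ hi]
  have := h1 i hi
  change _ = (1 - x i * x i) * (∏ a ∈ A.erase i, (1 - x i * x a)) *
    (((-1) / ((-1) - x i)) * ∏ a ∈ A.erase i, x a / (x a - x i))
  rw [show (-1 : K) - x i = -(1 + x i) by ring, neg_div_neg_eq]
  field_simp
  ring

end Interpolation

/-! ### The closed form and its two recursions -/

section BoundedSum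

variable {ι : Type*} [LinearOrder ι] {K : Type*} [Field K]

/-- The product `∏ 1 / (1 - x_a) ∏ 1 / (1 - x_a x_b)` of Littlewood's identity. -/
def littlewood (A : Finset ι) (x : ι → K) : K :=
  (∏ a ∈ A, (1 - x a)⁻¹) * ∏ a ∈ A, ∏ b ∈ A with b < a, (1 - x a * x b)⁻¹

theorem littlewood_insert {A : Finset ι} {i : ι} (hi : i ∉ A) (x : ι → K) :
    littlewood (insert i A) x =
      littlewood A x * ((1 - x i)⁻¹ * ∏ a ∈ A, (1 - x i * x a)⁻¹) := by
  have h1 : ∀ a ∈ A, ∏ b ∈ insert i A with b < a, (1 - x a * x b)⁻¹ =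
      (if i < a then (1 - x i * x a)⁻¹ else 1) * ∏ b ∈ A with b < a, (1 - x a * x b)⁻¹ := by
    intro a _
    rw [Finset.filter_insert]
    split_ifs with h
    · rw [Finset.prod_insert (by simp [hi]), mul_comm (x a) (x i)]
    · rw [one_mul]
  have h2 : (∏ b ∈ insert i A with b < i, (1 - x i * x b)⁻¹) *
      ∏ a ∈ A, (if i < a then (1 - x i * x a)⁻¹ else 1) = ∏ a ∈ A, (1 - x i * x a)⁻¹ := by
    rw [Finset.filter_insert, if_neg (lt_irrefl i), Finset.prod_filter, ← Finset.prod_mul_distrib]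
    refine Finset.prod_congr rfl fun a ha => ?_
    rcases lt_trichotomy a i with h | h | h
    · rw [if_pos h, if_neg h.not_gt, mul_one]
    · exact absurd (h ▸ ha) hi
    · rw [if_neg h.not_gt, if_pos h, one_mul]
  rw [littlewood, littlewood, Finset.prod_insert hi, Finset.prod_insert hi,
    Finset.prod_congr rfl h1, Finset.prod_mul_distrib, ← h2]
  ring

/-- The closed form of the sum of the Schur functions of all partitions with at most `r` parts, in
the variables indexed by `Y`. -/
def boundedSum (r : ℕ) (Y : Finset ι) (x : ι → K) : K :=
  ∑ A ∈ Y.powersetCard r, littlewood A x * ∏ a ∈ A, ∏ b ∈ Y \ A, x a / (x a - x b)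

theorem boundedSum_zero (Y : Finset ι) (x : ι → K) : boundedSum 0 Y x = 1 := by
  simp [boundedSum, littlewood]

theorem boundedSum_card {r : ℕ} {Y : Finset ι} (hY : Y.card = r) (x : ι → K) :
    boundedSum r Y x = littlewood Y x := by
  rw [boundedSum, ← hY, Finset.powersetCard_self, Finset.sum_singleton, Finset.sdiff_self]
  simp

/-- The counterpart of `schur_eq_sum_succAbove`. For fixed `A`, the part of the product over `A`
restores the missing factors `x_a / (x_a - x_b)`, and the rest sums over `b ∈ Y \ A` to `1` by
`sum_prod_div_sub`. -/
theorem boundedSum_eq_sum_erase {r : ℕ} {Y : Finset ι} (hr : r < Y.card) {x : ι → K}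
    (hx : Set.InjOn x Y) :
    boundedSum r Y x = ∑ b ∈ Y, (∏ a ∈ Y.erase b, x a / (x a - x b)) *
      boundedSum r (Y.erase b) x := by
  simp only [boundedSum, Finset.mul_sum]
  rw [Finset.sum_comm' (t' := Y.powersetCard r) (s' := fun A => Y \ A)]
  · refine Finset.sum_congr rfl fun A hA => ?_
    obtain ⟨hAY, hAr⟩ := Finset.mem_powersetCard.1 hA
    have hne : (Y \ A).Nonempty := by
      rw [← Finset.card_pos, Finset.card_sdiff_of_subset hAY]
      omega
    conv_lhs => rw [← mul_one (_ * _), ← sum_prod_div_sub (hx.mono (Finset.coe_subset.2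
      Finset.sdiff_subset)) hne, Finset.mul_sum]
    refine Finset.sum_congr rfl fun b hb => ?_
    obtain ⟨hbY, hbA⟩ := Finset.mem_sdiff.1 hb
    have e1 : Y.erase b = A ∪ (Y \ A).erase b := by
      ext c
      simp only [Finset.mem_erase, Finset.mem_union, Finset.mem_sdiff]
      constructor
      · rintro ⟨h1, h2⟩
        by_cases h : c ∈ A
        · exact Or.inl h
        · exact Or.inr ⟨h1, h2, h⟩
      · rintro (h | ⟨h1, h2, h⟩)
        · exact ⟨fun hc => hbA (hc ▸ h), hAY h⟩
        · exact ⟨h1, h2⟩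
    have e2 : Y.erase b \ A = (Y \ A).erase b := by
      rw [Finset.erase_sdiff_comm]
    have e3 : Disjoint A ((Y \ A).erase b) :=
      Finset.disjoint_left.2 fun c h1 h2 => (Finset.mem_sdiff.1 (Finset.mem_of_mem_erase h2)).2 h1
    rw [e2, e1, Finset.prod_union e3]
    have e4 : ∀ a ∈ A, ∏ c ∈ Y \ A, x a / (x a - x c) =
        x a / (x a - x b) * ∏ c ∈ (Y \ A).erase b, x a / (x a - x c) := fun a _ =>
      (Finset.mul_prod_erase _ _ hb).symm
    rw [Finset.prod_congr rfl e4, Finset.prod_mul_distrib]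
    ring
  · intro b A
    simp only [Finset.mem_powersetCard, Finset.mem_sdiff, Finset.subset_erase]
    tauto

/-- The counterpart of stripping full columns: the geometric factor sums over their number. The
`r`-subsets are the complements of single points, and `sum_prod_div_sub_mul_prod` adds their terms.
-/
theorem boundedSum_succ_card {r : ℕ} {Y : Finset ι} (hY : Y.card = r + 1) {x : ι → K}
    (hx : Set.InjOn x Y) (h1 : ∀ a ∈ Y, 1 + x a ≠ 0) (h2 : ∀ a ∈ Y, 1 - x a ≠ 0)
    (h3 : ∀ a ∈ Y, ∀ b ∈ Y, 1 - x a * x b ≠ 0) (h4 : 1 - ∏ a ∈ Y, x a ≠ 0) :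
    boundedSum (r + 1) Y x = (1 - ∏ a ∈ Y, x a)⁻¹ * boundedSum r Y x := by
  have e : boundedSum r Y x = ∑ i ∈ Y, littlewood (Y.erase i) x *
      ∏ a ∈ Y.erase i, x a / (x a - x i) := by
    rw [boundedSum]
    refine (Finset.sum_bij (fun i _ => Y.erase i) ?_ ?_ ?_ ?_).symm
    · intro i hi
      rw [Finset.mem_powersetCard, Finset.card_erase_of_mem hi, hY]
      exact ⟨Finset.erase_subset _ _, rfl⟩
    · intro i hi j hj h
      by_contra hne
      have : i ∈ Y.erase j := Finset.mem_erase.2 ⟨hne, hi⟩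
      rw [← h] at this
      exact Finset.notMem_erase i Y this
    · intro A hA
      obtain ⟨hAY, hAr⟩ := Finset.mem_powersetCard.1 hA
      have : (Y \ A).card = 1 := by
        rw [Finset.card_sdiff_of_subset hAY]
        omega
      obtain ⟨i, hi⟩ := Finset.card_eq_one.1 this
      have hi' : i ∈ Y \ A := hi ▸ Finset.mem_singleton_self i
      refine ⟨i, (Finset.mem_sdiff.1 hi').1, ?_⟩
      rw [Finset.erase_eq, ← hi, Finset.sdiff_sdiff_eq_self hAY]
    · intro i hi
      have : Y \ Y.erase i = {i} := by
        rw [Finset.erase_eq, Finset.sdiff_sdiff_eq_self (Finset.singleton_subset_iff.2 hi)]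
      simp [this]
  rw [boundedSum_card hY, e, eq_inv_mul_iff_mul_eq₀ h4, ← sum_prod_div_sub_mul_prod hx h1,
    Finset.sum_mul]
  refine Finset.sum_congr rfl fun i hi => ?_
  have h5 : ∏ a ∈ Y.erase i, (1 - x i * x a) ≠ 0 :=
    Finset.prod_ne_zero_iff.2 fun a ha => h3 i hi a (Finset.mem_of_mem_erase ha)
  have h6 := h2 i hi
  have h7 : littlewood Y x = littlewood (Y.erase i) x *
      ((1 - x i)⁻¹ * ∏ a ∈ Y.erase i, (1 - x i * x a)⁻¹) := by
    rw [← littlewood_insert (Finset.notMem_erase i Y), Finset.insert_erase hi]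
  rw [h7, Finset.prod_inv_distrib]
  field_simp

end BoundedSum

/-! ### Summation over partitions with a bounded number of parts -/

/-- Partitions with at most `r` parts. -/
abbrev BoundedPartition (r : ℕ) : Type := {μ : YoungDiagram // μ.colLen 0 ≤ r}

/-- Adding `k` columns of length `r` to a Young diagram. -/
def YoungDiagram.addColumns (r k : ℕ) (μ : YoungDiagram) : YoungDiagram :=
  YoungDiagram.ofAntitone r (fun i => k + μ.rowLen i)
    fun _ _ h => Nat.add_le_add_left (μ.rowLen_anti _ _ h) k

theorem YoungDiagram.rowLen_addColumns {r k : ℕ} {μ : YoungDiagram} {i : ℕ} (hi : i < r) :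
    (μ.addColumns r k).rowLen i = k + μ.rowLen i :=
  YoungDiagram.rowLen_ofAntitone hi

theorem YoungDiagram.colLen_addColumns (r k : ℕ) (μ : YoungDiagram) :
    (μ.addColumns r k).colLen 0 ≤ r :=
  YoungDiagram.colLen_zero_le_iff.2 fun _ _ h => (YoungDiagram.mem_ofAntitone.1 h).1

/-- A partition with at most `r + 1` parts is determined by its smallest part and the partition
obtained by subtracting this part from all parts. -/
noncomputable def stripColumns (r : ℕ) : ℕ × BoundedPartition r ≃ BoundedPartition (r + 1) :=
  Equiv.ofBijective
    (fun z => ⟨z.2.1.addColumns (r + 1) z.1, z.2.1.colLen_addColumns (r + 1) z.1⟩) <| by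
    constructor
    · rintro ⟨k, μ, hμ⟩ ⟨k', μ', hμ'⟩ h
      have h1 : ∀ i < r + 1, k + μ.rowLen i = k' + μ'.rowLen i := by
        intro i hi
        have := congrArg (fun z : BoundedPartition (r + 1) => z.1.rowLen i) h
        simpa only [YoungDiagram.rowLen_addColumns hi] using this
      have hk : k = k' := by
        have := h1 r (Nat.lt_succ_self r)
        rwa [YoungDiagram.rowLen_eq_zero hμ le_rfl, YoungDiagram.rowLen_eq_zero hμ' le_rfl] at this
      have : μ = μ' := YoungDiagram.ext_rowLen hμ hμ' fun i hi => by
        have := h1 i (by omega)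
        omega
      subst hk this
      rfl
    · rintro ⟨ν, hν⟩
      have hanti : Antitone fun i => ν.rowLen i - ν.rowLen r := fun i j h =>
        Nat.sub_le_sub_right (ν.rowLen_anti _ _ h) _
      refine ⟨⟨ν.rowLen r, YoungDiagram.ofAntitone r _ hanti,
        YoungDiagram.colLen_zero_le_iff.2 fun i k h => (YoungDiagram.mem_ofAntitone.1 h).1⟩, ?_⟩
      refine Subtype.ext (YoungDiagram.ext_rowLen (YoungDiagram.colLen_addColumns _ _ _) hν
        fun i hi => ?_)
      rw [YoungDiagram.rowLen_addColumns hi]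
      change _ = ν.rowLen i
      rcases Nat.lt_succ_iff_lt_or_eq.1 hi with h | h
      · rw [YoungDiagram.rowLen_ofAntitone h]
        have := ν.rowLen_anti i r h.le
        omega
      · subst h
        rw [YoungDiagram.rowLen_eq_zero
          (YoungDiagram.colLen_zero_le_iff.2 fun i k h => (YoungDiagram.mem_ofAntitone.1 h).1)
          le_rfl]
        rfl

theorem boundedPartition_zero (μ : BoundedPartition 0) : μ.1 = ⊥ :=
  YoungDiagram.ext_rowLen μ.2
    (YoungDiagram.colLen_zero_le_iff.2 fun _ _ h => absurd h (YoungDiagram.notMem_bot _))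
    fun i hi => absurd hi (Nat.not_lt_zero i)

instance uniqueBoundedPartitionZero : Unique (BoundedPartition 0) where
  default := ⟨⊥, YoungDiagram.colLen_zero_le_iff.2 fun _ _ h =>
    absurd h (YoungDiagram.notMem_bot _)⟩
  uniq μ := Subtype.ext (boundedPartition_zero μ)

theorem schur_bot {R : Type*} [CommSemiring R] {p : ℕ} (x : Fin p → R) :
    schur ⊥ x = 1 := by
  have hu : Unique (BoundedSSYT p ⊥) :=
    { default := ⟨SemistandardYoungTableau.highestWeight ⊥, by simp⟩
      uniq := fun T => BoundedSSYT.ext_entry fun i k hm => absurd hm (YoungDiagram.notMem_bot _) }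
  rw [schur_eq_sum, Fintype.sum_unique]
  simp

theorem schur_nonneg {p : ℕ} (μ : YoungDiagram) {x : Fin p → ℝ} (hx : ∀ i, 0 ≤ x i) :
    0 ≤ schur μ x :=
  Finset.sum_nonneg fun _ _ => Finset.prod_nonneg fun _ _ => hx _

theorem schur_mono {p : ℕ} (μ : YoungDiagram) {x y : Fin p → ℝ} (hx : ∀ i, 0 ≤ x i)
    (h : ∀ i, x i ≤ y i) : schur μ x ≤ schur μ y :=
  Finset.sum_le_sum fun _ _ => Finset.prod_le_prod (fun _ _ => hx _) fun _ _ => h _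

theorem HasSum.mul_nonneg_real {ι κ : Type*} {f : ι → ℝ} {g : κ → ℝ} {a b : ℝ} (hf : HasSum f a)
    (hg : HasSum g b) (hf0 : ∀ i, 0 ≤ f i) (hg0 : ∀ j, 0 ≤ g j) :
    HasSum (fun z : ι × κ => f z.1 * g z.2) (a * b) :=
  hf.mul hg (hf.summable.mul_of_nonneg hg.summable hf0 hg0)

attribute [local irreducible] schur in
theorem schur_stripColumns {r : ℕ} {x : Fin (r + 1) → ℝ} (hx : Function.Injective x)
    (z : ℕ × BoundedPartition r) :
    schur (stripColumns r z).1 x = (∏ i, x i) ^ z.1 * schur z.2.1 x :=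
  schur_shift (z.2.2.trans (Nat.le_succ r)) (YoungDiagram.colLen_addColumns _ _ _)
    (fun _ hi => YoungDiagram.rowLen_addColumns hi) hx

attribute [local irreducible] schur in
-- Induction on `r`, and for each positive `r` on `p`. When `p` equals the allowed number of parts,
-- full columns are stripped, which reduces to fewer parts in the same variables; beyond that, one
-- variable is removed at a time. Nonnegativity of the terms justifies multiplying the series.
theorem hasSum_schur {ι : Type*} [LinearOrder ι] {x : ι → ℝ} (hx : Function.Injective x)
    (h0 : ∀ i, 0 < x i) (h1 : ∀ i, x i < 1) (r p : ℕ) (hrp : r ≤ p) (e : Fin p → ι)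
    (he : Function.Injective e) :
    HasSum (fun μ : BoundedPartition r => schur μ.1 fun i => x (e i))
      (boundedSum r (Finset.univ.image e) x) := by
  induction r generalizing p with
  | zero =>
    rw [boundedSum_zero]
    have : (fun μ : BoundedPartition 0 => schur μ.1 fun i => x (e i)) = fun _ => 1 := by
      funext μ
      rw [boundedPartition_zero μ, schur_bot]
    rw [this]
    exact hasSum_unique _
  | succ r ihr =>
    induction p, hrp using Nat.le_induction with
    | base =>
      have hcard : (Finset.univ.image e).card = r + 1 := by
        rw [Finset.card_image_of_injective _ he, Finset.card_univ, Fintype.card_fin]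
      have hlt : ∏ i, x (e i) < 1 := by
        have := Finset.prod_lt_prod_of_nonempty (s := Finset.univ) (f := fun i => x (e i))
          (g := fun _ => (1 : ℝ)) (fun i _ => h0 _) (fun i _ => h1 _) Finset.univ_nonempty
        simpa using this
      have hprod : ∏ a ∈ Finset.univ.image e, x a = ∏ i, x (e i) :=
        Finset.prod_image fun i _ j _ h => he h
      rw [boundedSum_succ_card hcard hx.injOn (fun a _ => by linarith [h0 a])
        (fun a _ => by linarith [h1 a])
        (fun a _ b _ => by nlinarith [h0 a, h1 a, h0 b, h1 b]) (by rw [hprod]; linarith),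
        hprod, ← (stripColumns r).hasSum_iff]
      have hpos : 0 ≤ ∏ i, x (e i) := Finset.prod_nonneg fun i _ => (h0 _).le
      have hg := hasSum_geometric_of_lt_one hpos hlt
      have hs := ihr (r + 1) (Nat.le_succ r) e he
      have := hg.mul_nonneg_real hs (fun k => pow_nonneg hpos k)
        fun μ => schur_nonneg _ fun i => (h0 _).le
      have h5 : (fun μ : BoundedPartition (r + 1) => schur μ.1 fun i => x (e i)) ∘
          stripColumns r = fun z => (∏ i, x (e i)) ^ z.1 * schur z.2.1 fun i => x (e i) :=
        funext fun z => schur_stripColumns (hx.comp he) z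
      rw [h5]
      exact this
    | succ p hp ih =>
      have hcard : (Finset.univ.image e).card = p + 1 := by
        rw [Finset.card_image_of_injective _ he, Finset.card_univ, Fintype.card_fin]
      rw [boundedSum_eq_sum_erase (by omega) hx.injOn, Finset.sum_image fun i _ j _ h => he h]
      have h2 : ∀ μ : BoundedPartition (r + 1), schur μ.1 (fun i => x (e i)) =
          ∑ b : Fin (p + 1), (∏ a : Fin p, x (e (b.succAbove a)) /
            (x (e (b.succAbove a)) - x (e b))) * schur μ.1 (fun a => x (e (b.succAbove a))) :=
        fun μ => schur_eq_sum_succAbove μ.1 (μ.2.trans hp) (hx.comp he)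
      simp only [h2]
      refine hasSum_sum fun b _ => ?_
      have h3 : (Finset.univ.image e).erase (e b) =
          Finset.univ.image fun a : Fin p => e (b.succAbove a) := by
        ext c
        simp only [Finset.mem_erase, Finset.mem_image, Finset.mem_univ, true_and]
        constructor
        · rintro ⟨hc, d, rfl⟩
          obtain ⟨a, rfl⟩ := Fin.exists_succAbove_eq (x := d) (y := b) fun h => hc (h ▸ rfl)
          exact ⟨a, rfl⟩
        · rintro ⟨a, rfl⟩
          exact ⟨fun h => Fin.succAbove_ne b a (he h), _, rfl⟩
      rw [h3, Finset.prod_image fun i _ j _ h => Fin.succAbove_right_injective (he h)]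
      exact (ih _ (he.comp Fin.succAbove_right_injective)).mul_left _

/-! ### The limit as `q` tends to `1` -/

theorem one_sub_mul_inv_tendsto {c : ℝ} (hc : c ≠ 0) :
    Filter.Tendsto (fun q : ℝ => (1 - q) * (1 - q ^ c)⁻¹) (𝓝[<] 1) (𝓝 c⁻¹) := by
  have h := (Real.hasDerivAt_rpow_const (x := 1) (p := c) (Or.inl one_ne_zero)).tendsto_slope
  rw [Real.one_rpow, mul_one] at h
  have h1 := (h.mono_left (nhdsWithin_mono 1 (fun q (hq : q < 1) => ne_of_lt hq))).inv₀ hc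
  refine h1.congr' ?_
  filter_upwards with q
  rw [slope_def_field, Real.one_rpow, inv_div, div_eq_mul_inv, ← neg_sub 1 q,
    ← neg_sub 1 (q ^ c), inv_neg, neg_mul_neg]

/-- The limit, as `q → 1`, of `(1 - q) ^ N` times the sum of the Schur functions of all
partitions with at most `r` parts, evaluated at `q ^ (1 + s), …, q ^ (p + s)`. -/
noncomputable def limitSum (r p : ℕ) (s : ℝ) : ℝ :=
  ∑ A ∈ (Finset.univ : Finset (Fin p)).powersetCard r,
    ((∏ a ∈ A, ((a : ℝ) + 1 + s)⁻¹) *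
      ∏ a ∈ A, ∏ b ∈ A with b < a, ((a : ℝ) + 1 + s + ((b : ℝ) + 1 + s))⁻¹) *
    ∏ a ∈ A, ∏ b ∈ Finset.univ \ A, ((b : ℝ) - a)⁻¹

theorem card_lt_pairs {ι : Type*} [LinearOrder ι] (A : Finset ι) :
    ∑ a ∈ A, (A.filter (· < a)).card = A.card.choose 2 := by
  induction A using Finset.induction_on_max with
  | empty => simp
  | insert m A hm ih =>
    have hmA : m ∉ A := fun h => lt_irrefl _ (hm m h)
    rw [Finset.sum_insert hmA, Finset.card_insert_of_notMem hmA, Nat.choose_succ_succ',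
      Nat.choose_one_right, ← ih, Finset.filter_insert, if_neg (lt_irrefl m),
      Finset.filter_true_of_mem hm]
    congr 1
    refine Finset.sum_congr rfl fun a ha => ?_
    rw [Finset.filter_insert, if_neg (hm a ha).not_gt]

theorem exponent_eq {r p : ℕ} (hrp : r ≤ p) :
    r * p - r.choose 2 = r + r.choose 2 + r * (p - r) := by
  obtain ⟨d, rfl⟩ := Nat.exists_eq_add_of_le hrp
  have h2 : r + r.choose 2 + r.choose 2 = r * r := by
    rw [Nat.choose_two_right]
    have := Nat.even_mul_pred_self r
    rcases r with _ | r
    · simp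
    · rw [Nat.add_sub_cancel] at this ⊢
      have h3 := Nat.div_mul_cancel this.two_dvd
      nlinarith
  rw [Nat.add_sub_cancel_left, mul_add]
  omega

/-- Every factor becomes `(1 - q ^ c)⁻¹` with `c ≠ 0`, and each term has `r + r.choose 2 + r * (p -
r)` of them, so one factor `1 - q` can be given to each. -/
theorem tendsto_boundedSum {r p : ℕ} (hrp : r ≤ p) {s : ℝ} (hs : -1 < s) :
    Filter.Tendsto (fun q : ℝ => (1 - q) ^ (r * p - r.choose 2) *
      boundedSum r Finset.univ fun i : Fin p => q ^ (((i : ℕ) : ℝ) + 1 + s))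
      (𝓝[<] 1) (𝓝 (limitSum r p s)) := by
  have hpos : ∀ a : Fin p, 0 < (a : ℝ) + 1 + s := fun a => by
    have : (0 : ℝ) ≤ (a : ℕ) := Nat.cast_nonneg _
    linarith
  have key : Filter.Tendsto (fun q : ℝ =>
      ∑ A ∈ (Finset.univ : Finset (Fin p)).powersetCard r,
        ((∏ a ∈ A, ((1 - q) * (1 - q ^ ((a : ℝ) + 1 + s))⁻¹)) *
          ∏ a ∈ A, ∏ b ∈ A with b < a,
            ((1 - q) * (1 - q ^ ((a : ℝ) + 1 + s + ((b : ℝ) + 1 + s)))⁻¹)) *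
        ∏ a ∈ A, ∏ b ∈ Finset.univ \ A, ((1 - q) * (1 - q ^ ((b : ℝ) - a))⁻¹))
      (𝓝[<] 1) (𝓝 (limitSum r p s)) := by
    refine tendsto_finsetSum _ fun A _ => ((tendsto_finsetProd _ fun a _ => ?_).mul
      (tendsto_finsetProd _ fun a _ => tendsto_finsetProd _ fun b _ => ?_)).mul
      (tendsto_finsetProd _ fun a ha => tendsto_finsetProd _ fun b hb => ?_)
    · exact one_sub_mul_inv_tendsto (hpos a).ne'
    · exact one_sub_mul_inv_tendsto (add_pos (hpos a) (hpos b)).ne'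
    · refine one_sub_mul_inv_tendsto (sub_ne_zero.2 fun h => ?_)
      have : b = a := Fin.ext (Nat.cast_injective h)
      exact (Finset.mem_sdiff.1 hb).2 (this ▸ ha)
  refine key.congr' ?_
  have hmem : Set.Ioo (0 : ℝ) 1 ∈ 𝓝[<] (1 : ℝ) := Ioo_mem_nhdsLT one_pos
  filter_upwards [hmem] with q hq
  rw [boundedSum, Finset.mul_sum]
  refine Finset.sum_congr rfl fun A hA => ?_
  have hAr : A.card = r := (Finset.mem_powersetCard.1 hA).2
  have e3 : ∀ a b : Fin p, q ^ ((a : ℝ) + 1 + s) / (q ^ ((a : ℝ) + 1 + s) - q ^ ((b : ℝ) + 1 + s)) =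
      (1 - q ^ ((b : ℝ) - a))⁻¹ := by
    intro a b
    have h0 : q ^ ((a : ℝ) + 1 + s) ≠ 0 := (Real.rpow_pos_of_pos hq.1 _).ne'
    have : q ^ ((b : ℝ) + 1 + s) = q ^ ((a : ℝ) + 1 + s) * q ^ ((b : ℝ) - a) := by
      rw [← Real.rpow_add hq.1]
      congr 1
      ring
    rw [this, ← mul_one_sub, ← div_div, div_self h0, one_div]
  have hc : (Finset.univ \ A).card = p - r := by
    rw [Finset.card_sdiff_of_subset (Finset.subset_univ A), hAr, Finset.card_univ,
      Fintype.card_fin]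
  simp only [littlewood, e3, Finset.prod_mul_distrib, Finset.prod_const, ← Real.rpow_add hq.1, hc,
    Finset.prod_pow_eq_pow_sum, card_lt_pairs, hAr, exponent_eq hrp]
  ring

/-! ### Poles of the limit in the parameter `s` -/

/-- The multiplicity of the factor `l + 2 s` in the denominator of `E1 r p s`. -/
def poleOrder (r p l : ℕ) : ℕ :=
  min (if Even l then (r + 1) / 2 else r / 2) (min (l / 2) ((2 * p + 2 - l) / 2))

/-- The pairs `b ≤ a` in `A`. -/
def weakPairs {p : ℕ} (A : Finset (Fin p)) : Finset (Fin p × Fin p) :=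
  (A ×ˢ A).filter fun z => z.2 ≤ z.1

/-- Either entry of a pair with sum `l` determines the other, so the pairs are disjoint as subsets
of `A` and all have two elements except possibly a diagonal one, which needs `l` even. This gives
the bound in terms of `A.card`; the other two bounds count the possible smaller and larger entries.
-/
theorem card_weakPairs_le {p : ℕ} (A : Finset (Fin p)) (l : ℕ) :
    ((weakPairs A).filter fun z => (z.1 : ℕ) + 1 + (z.2 + 1) = l).card ≤
      poleOrder A.card p l := by
  set P := (weakPairs A).filter fun z => (z.1 : ℕ) + 1 + (z.2 + 1) = l with hP
  have hmem : ∀ z ∈ P, z.1 ∈ A ∧ z.2 ∈ A ∧ (z.2 : ℕ) ≤ z.1 ∧ (z.1 : ℕ) + 1 + (z.2 + 1) = l := by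
    intro z hz
    simp only [hP, weakPairs, Finset.mem_filter, Finset.mem_product] at hz
    exact ⟨hz.1.1.1, hz.1.1.2, hz.1.2, hz.2⟩
  have inj1 : Set.InjOn (fun z : Fin p × Fin p => z.1) P := by
    intro z hz w hw h
    have h1 := (hmem z hz).2.2.2
    have h2 := (hmem w hw).2.2.2
    have h : z.1 = w.1 := h
    refine Prod.ext h (Fin.ext ?_)
    rw [h] at h1
    omega
  have inj2 : Set.InjOn (fun z : Fin p × Fin p => z.2) P := by
    intro z hz w hw h
    have h1 := (hmem z hz).2.2.2
    have h2 := (hmem w hw).2.2.2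
    have h : z.2 = w.2 := h
    refine Prod.ext (Fin.ext ?_) h
    rw [h] at h1
    omega
  have b1 : P.card ≤ l / 2 := by
    have := Finset.card_le_card_of_injOn (t := Finset.range (l / 2))
      (fun z : Fin p × Fin p => (z.2 : ℕ)) (fun z hz => by
        have := hmem z hz
        exact Finset.mem_coe.2 (Finset.mem_range.2 (show (z.2 : ℕ) < l / 2 by omega)))
      (fun z hz w hw h => inj2 hz hw (Fin.ext h))
    simpa using this
  have b2 : P.card ≤ (2 * p + 2 - l) / 2 := by
    have := Finset.card_le_card_of_injOn (t := Finset.Ico ((l + 1) / 2 - 1) p)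
      (fun z : Fin p × Fin p => (z.1 : ℕ)) (fun z hz => by
        have := hmem z hz
        exact Finset.mem_coe.2 (Finset.mem_Ico.2
          ⟨show (l + 1) / 2 - 1 ≤ (z.1 : ℕ) by omega, z.1.2⟩))
      (fun z hz w hw h => inj1 hz hw (Fin.ext h))
    rw [Nat.card_Ico] at this
    rcases P.eq_empty_or_nonempty with h | ⟨z, hz⟩
    · simp [h]
    · have := hmem z hz
      have := z.1.2
      omega
  have b3 : P.card + P.card ≤ A.card +
      (P.image (fun z => z.1) ∩ P.image (fun z => z.2)).card := by
    have h1 := Finset.card_union_add_card_inter (P.image fun z => z.1) (P.image fun z => z.2)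
    rw [Finset.card_image_of_injOn inj1, Finset.card_image_of_injOn inj2] at h1
    have h2 : (P.image (fun z => z.1) ∪ P.image (fun z => z.2)).card ≤ A.card := by
      refine Finset.card_le_card (Finset.union_subset ?_ ?_)
      · exact Finset.image_subset_iff.2 fun z hz => (hmem z hz).1
      · exact Finset.image_subset_iff.2 fun z hz => (hmem z hz).2.1
    omega
  have hint : ∀ a : Fin p, a ∈ P.image (fun z => z.1) ∩ P.image (fun z => z.2) →
      2 * ((a : ℕ) + 1) = l := by
    intro a ha
    obtain ⟨h1, h2⟩ := Finset.mem_inter.1 ha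
    obtain ⟨z, hz, rfl⟩ := Finset.mem_image.1 h1
    obtain ⟨w, hw, h⟩ := Finset.mem_image.1 h2
    have hz := hmem z hz
    have hw := hmem w hw
    have h : (w.2 : ℕ) = z.1 := congrArg Fin.val h
    omega
  have b4 : (P.image (fun z => z.1) ∩ P.image (fun z => z.2)).card ≤ 1 :=
    Finset.card_le_one.2 fun a ha b hb => Fin.ext (by have := hint a ha; have := hint b hb; omega)
  refine le_min ?_ (le_min b1 b2)
  split_ifs with hl
  · omega
  · have : (P.image (fun z => z.1) ∩ P.image (fun z => z.2)).card = 0 := by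
      rw [Finset.card_eq_zero]
      refine Finset.eq_empty_of_forall_notMem fun a ha => hl ?_
      rw [← hint a ha]
      exact even_two_mul _
    omega

/-- The denominator of `E1 r p s`, up to a constant factor. -/
noncomputable def denomE1 (r p : ℕ) (s : ℝ) : ℝ :=
  ∏ l ∈ Finset.Icc 2 (2 * p), ((l : ℝ) + 2 * s) ^ poleOrder r p l

theorem factor_pos {s : ℝ} (hs : -1 < s) {l : ℕ} (hl : 2 ≤ l) : 0 < (l : ℝ) + 2 * s := by
  have : (2 : ℝ) ≤ l := by exact_mod_cast hl
  linarith

theorem denomE1_pos {r p : ℕ} {s : ℝ} (hs : -1 < s) : 0 < denomE1 r p s :=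
  Finset.prod_pos fun _ hl => pow_pos (factor_pos hs (Finset.mem_Icc.1 hl).1) _

/-- The single factors are the diagonal pairs: `(a + 1 + s)⁻¹` is twice the inverse of `2(a + 1) +
2s`, which accounts for the power of `2`. -/
theorem prod_weakPairs {p : ℕ} (A : Finset (Fin p)) (s : ℝ) :
    (∏ a ∈ A, ((a : ℝ) + 1 + s)⁻¹) *
      ∏ a ∈ A, ∏ b ∈ A with b < a, ((a : ℝ) + 1 + s + ((b : ℝ) + 1 + s))⁻¹ =
    2 ^ A.card * ∏ l ∈ Finset.Icc 2 (2 * p), (((l : ℝ) + 2 * s)⁻¹) ^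
      ((weakPairs A).filter fun z => (z.1 : ℕ) + 1 + (z.2 + 1) = l).card := by
  have h1 : ∏ z ∈ weakPairs A, ((((z.1 : ℕ) + 1 + (z.2 + 1) : ℕ) : ℝ) + 2 * s)⁻¹ =
      ∏ l ∈ Finset.Icc 2 (2 * p), (((l : ℝ) + 2 * s)⁻¹) ^
        ((weakPairs A).filter fun z => (z.1 : ℕ) + 1 + (z.2 + 1) = l).card := by
    rw [← Finset.prod_fiberwise_of_maps_to (s := weakPairs A) (t := Finset.Icc 2 (2 * p))
      (g := fun z : Fin p × Fin p => (z.1 : ℕ) + 1 + (z.2 + 1)) (fun z _ => by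
        have := z.1.2
        have := z.2.2
        exact Finset.mem_Icc.2 (by omega))]
    refine Finset.prod_congr rfl fun l _ => Finset.prod_eq_pow_card fun z hz => ?_
    rw [(Finset.mem_filter.1 hz).2]
  rw [← h1, weakPairs, Finset.prod_filter, Finset.prod_product, ← Finset.prod_const,
    ← Finset.prod_mul_distrib, ← Finset.prod_mul_distrib]
  refine Finset.prod_congr rfl fun a ha => ?_
  rw [← Finset.prod_filter]
  have h2 : (A.filter fun b => b ≤ a) = insert a (A.filter fun b => b < a) := by
    ext b
    simp only [Finset.mem_filter, Finset.mem_insert]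
    constructor
    · rintro ⟨h, h'⟩
      rcases h'.eq_or_lt with h' | h'
      · exact Or.inl h'
      · exact Or.inr ⟨h, h'⟩
    · rintro (rfl | ⟨h, h'⟩)
      · exact ⟨ha, le_rfl⟩
      · exact ⟨h, h'.le⟩
  rw [h2, Finset.prod_insert (by simp), ← mul_assoc]
  congr 1
  · push_cast
    rw [show (a : ℝ) + 1 + (a + 1) + 2 * s = 2 * (a + 1 + s) by ring, mul_inv]
    ring
  · refine Finset.prod_congr rfl fun b _ => ?_
    push_cast
    congr 1
    ring

/-- The numerator of `limitSum r p s` over `denomE1 r p s`. -/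
noncomputable def numerPoly (r p : ℕ) : Polynomial ℝ :=
  ∑ A ∈ (Finset.univ : Finset (Fin p)).powersetCard r,
    Polynomial.C (2 ^ r * ∏ a ∈ A, ∏ b ∈ Finset.univ \ A, ((b : ℝ) - a)⁻¹) *
      ∏ l ∈ Finset.Icc 2 (2 * p), (Polynomial.C (l : ℝ) + 2 * Polynomial.X) ^
        (poleOrder r p l -
          ((weakPairs A).filter fun z => (z.1 : ℕ) + 1 + (z.2 + 1) = l).card)

theorem limitSum_mul_denomE1 (r p : ℕ) {s : ℝ} (hs : -1 < s) :
    limitSum r p s * denomE1 r p s = (numerPoly r p).eval s := by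
  rw [limitSum, numerPoly, Polynomial.eval_finsetSum, Finset.sum_mul]
  refine Finset.sum_congr rfl fun A hA => ?_
  have hA := (Finset.mem_powersetCard.1 hA).2
  rw [prod_weakPairs, Polynomial.eval_mul, Polynomial.eval_C, Polynomial.eval_prod, hA, denomE1]
  have h : ∏ l ∈ Finset.Icc 2 (2 * p), ((Polynomial.C (l : ℝ) + 2 * Polynomial.X) ^
        (poleOrder r p l -
          ((weakPairs A).filter fun z : Fin p × Fin p => (z.1 : ℕ) + 1 + (z.2 + 1) = l).card)).eval s =
      (∏ l ∈ Finset.Icc 2 (2 * p), (((l : ℝ) + 2 * s)⁻¹) ^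
        ((weakPairs A).filter fun z => (z.1 : ℕ) + 1 + (z.2 + 1) = l).card) *
      ∏ l ∈ Finset.Icc 2 (2 * p), ((l : ℝ) + 2 * s) ^ poleOrder r p l := by
    rw [← Finset.prod_mul_distrib]
    refine Finset.prod_congr rfl fun l hl => ?_
    have h0 := (factor_pos hs (Finset.mem_Icc.1 hl).1).ne'
    have h1 := card_weakPairs_le A l
    rw [hA] at h1
    simp only [Polynomial.eval_pow, Polynomial.eval_add, Polynomial.eval_C, Polynomial.eval_mul,
      Polynomial.eval_X, Polynomial.eval_ofNat]
    rw [pow_sub₀ _ h0 h1, inv_pow, mul_comm]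
  rw [h]
  ring

/-! ### Comparison of the pole orders with `E1` -/

/-- For even `r` the exponent is symmetric under `l ↦ 2p + 2 - l`: it grows as `l / 2`, stays at `m`
in the middle range, and descends by reflection. -/
theorem prod_poleOrder_even {M : Type*} [CommMonoid M] {m p : ℕ} (hm : 2 * m ≤ p) (φ : ℕ → M) :
    ∏ l ∈ Finset.Icc 2 (2 * p), φ l ^ poleOrder (2 * m) p l =
      (∏ l ∈ Finset.Ioo (2 * m) (2 * p + 2 - 2 * m), φ l ^ m) *
        ∏ l ∈ Finset.Icc 2 (2 * m), (φ l * φ (2 * p + 2 - l)) ^ (l / 2) := by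
  rcases Nat.eq_zero_or_pos m with rfl | hm0
  · simp [poleOrder]
  have hlow : ∀ l, poleOrder (2 * m) p l = min m (min (l / 2) ((2 * p + 2 - l) / 2)) := by
    intro l
    rw [poleOrder]
    split_ifs <;> congr 1 <;> omega
  have e1 : Finset.Icc 2 (2 * p) = Finset.Ico 2 (2 * p + 1) := rfl
  have e2 : Finset.Icc 2 (2 * m) = Finset.Ico 2 (2 * m + 1) := rfl
  have e3 : Finset.Ioo (2 * m) (2 * p + 2 - 2 * m) =
      Finset.Ico (2 * m + 1) (2 * p + 2 - 2 * m) := rfl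
  simp only [mul_pow, Finset.prod_mul_distrib]
  rw [e1, e2, e3, ← Finset.prod_Ico_consecutive _ (show 2 ≤ 2 * m + 1 by omega)
    (show 2 * m + 1 ≤ 2 * p + 1 by omega), ← Finset.prod_Ico_consecutive _
    (show 2 * m + 1 ≤ 2 * p + 2 - 2 * m by omega) (show 2 * p + 2 - 2 * m ≤ 2 * p + 1 by omega)]
  have a1 : ∏ l ∈ Finset.Ico 2 (2 * m + 1), φ l ^ poleOrder (2 * m) p l =
      ∏ l ∈ Finset.Ico 2 (2 * m + 1), φ l ^ (l / 2) :=
    Finset.prod_congr rfl fun l hl => by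
      have := Finset.mem_Ico.1 hl
      rw [hlow]
      congr 1
      omega
  have a2 : ∏ l ∈ Finset.Ico (2 * m + 1) (2 * p + 2 - 2 * m), φ l ^ poleOrder (2 * m) p l =
      ∏ l ∈ Finset.Ico (2 * m + 1) (2 * p + 2 - 2 * m), φ l ^ m :=
    Finset.prod_congr rfl fun l hl => by
      have := Finset.mem_Ico.1 hl
      rw [hlow]
      congr 1
      omega
  have a3 : ∏ l ∈ Finset.Ico (2 * p + 2 - 2 * m) (2 * p + 1), φ l ^ poleOrder (2 * m) p l =
      ∏ l ∈ Finset.Ico 2 (2 * m + 1), φ (2 * p + 2 - l) ^ (l / 2) := by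
    refine Finset.prod_bij' (fun l _ => 2 * p + 2 - l) (fun l _ => 2 * p + 2 - l) ?_ ?_ ?_ ?_ ?_
    · intro l hl
      have := Finset.mem_Ico.1 hl
      exact Finset.mem_Ico.2 (by omega)
    · intro l hl
      have := Finset.mem_Ico.1 hl
      exact Finset.mem_Ico.2 (by omega)
    · intro l hl
      have := Finset.mem_Ico.1 hl
      omega
    · intro l hl
      have := Finset.mem_Ico.1 hl
      omega
    · intro l hl
      have := Finset.mem_Ico.1 hl
      rw [hlow]
      congr 1
      · congr 1
        omega
      · omega
  rw [a1, a2, a3, mul_left_comm]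

/-- Going from `2m` to `2m + 1` raises the cap on the exponent only for even `l`, and only where the
other bounds leave room. These extra factors form the Gamma quotient of odd `E1`. -/
theorem prod_poleOrder_odd {M : Type*} [CommMonoid M] {m p : ℕ} (hm : 2 * m + 1 ≤ p)
    (φ : ℕ → M) :
    ∏ l ∈ Finset.Icc 2 (2 * p), φ l ^ poleOrder (2 * m + 1) p l =
      (∏ l ∈ Finset.Icc 2 (2 * p), φ l ^ poleOrder (2 * m) p l) *
        ∏ k ∈ Finset.Ico (m + 1) (p - m + 1), φ (2 * k) := by
  have h1 : ∏ k ∈ Finset.Ico (m + 1) (p - m + 1), φ (2 * k) =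
      ∏ l ∈ Finset.Icc 2 (2 * p), if Even l ∧ 2 * m + 2 ≤ l ∧ l ≤ 2 * p - 2 * m then φ l else 1 := by
    rw [← Finset.prod_filter]
    refine Finset.prod_bij (fun k _ => 2 * k) ?_ ?_ ?_ fun _ _ => rfl
    · intro k hk
      have := Finset.mem_Ico.1 hk
      exact Finset.mem_filter.2 ⟨Finset.mem_Icc.2 (by omega), even_two_mul k, by omega, by omega⟩
    · intro k _ k' _ h
      have h : 2 * k = 2 * k' := h
      omega
    · intro l hl
      obtain ⟨-, ⟨k, hk⟩, h2, h3⟩ := Finset.mem_filter.1 hl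
      exact ⟨k, Finset.mem_Ico.2 (by omega), by omega⟩
  rw [h1, ← Finset.prod_mul_distrib]
  refine Finset.prod_congr rfl fun l _ => ?_
  by_cases hl : Even l
  · obtain ⟨k, hk⟩ := id hl
    split_ifs with h
    · rw [← pow_succ]
      congr 1
      rw [poleOrder, poleOrder, if_pos hl, if_pos hl]
      omega
    · rw [mul_one]
      congr 1
      rw [poleOrder, poleOrder, if_pos hl, if_pos hl]
      have : ¬ (2 * m + 2 ≤ l ∧ l ≤ 2 * p - 2 * m) := fun h' => h ⟨hl, h'⟩
      omega
  · rw [if_neg (fun h => hl h.1), mul_one]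
    congr 1
    rw [poleOrder, poleOrder, if_neg hl, if_neg hl]
    congr 1
    omega

/-- Multiplicative form of the statement that the pole orders add up to `N`, the degree of `denomE1`
in `s`. -/
theorem prod_const_poleOrder {M : Type*} [CommMonoid M] {r p : ℕ} (hrp : r ≤ p) (c : M) :
    ∏ l ∈ Finset.Icc 2 (2 * p), c ^ poleOrder r p l = c ^ (r * p - r.choose 2) := by
  have hsum : ∀ m : ℕ, ∑ l ∈ Finset.Icc 2 (2 * m), l / 2 = m * m := by
    intro m
    induction m with
    | zero => simp
    | succ m ih =>
      rcases Nat.eq_zero_or_pos m with rfl | hm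
      · decide
      rw [show 2 * (m + 1) = 2 * m + 1 + 1 by ring, Finset.sum_Icc_succ_top (by omega),
        Finset.sum_Icc_succ_top (by omega), ih]
      have h1 : (2 * m + 1) / 2 = m := by omega
      have h2 : (2 * m + 1 + 1) / 2 = m + 1 := by omega
      rw [h1, h2]
      ring
  have heven : ∀ m : ℕ, 2 * m ≤ p → ∏ l ∈ Finset.Icc 2 (2 * p), c ^ poleOrder (2 * m) p l =
      c ^ (m * (2 * p + 1 - 4 * m) + 2 * (m * m)) := by
    intro m hm
    rw [prod_poleOrder_even hm, Finset.prod_const, Nat.card_Ioo, Finset.prod_pow_eq_pow_sum, hsum,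
      ← pow_mul, ← pow_two, ← pow_mul, ← pow_add]
    congr 3
    omega
  rcases Nat.even_or_odd' r with ⟨m, rfl | rfl⟩
  · rw [heven m hrp]
    congr 1
    obtain ⟨d, rfl⟩ := Nat.exists_eq_add_of_le hrp
    rw [exponent_eq hrp, Nat.choose_two_right, Nat.mul_assoc,
      Nat.mul_div_cancel_left _ (by norm_num)]
    rcases m with _ | m
    · simp
    · have h1 : 2 * (2 * (m + 1) + d) + 1 - 4 * (m + 1) = 2 * d + 1 := by omega
      have h2 : 2 * (m + 1) - 1 = 2 * m + 1 := by omega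
      rw [h1, h2, Nat.add_sub_cancel_left]
      ring
  · rw [prod_poleOrder_odd hrp, heven m (by omega), Finset.prod_const, Nat.card_Ico, ← pow_add]
    congr 1
    obtain ⟨d, rfl⟩ := Nat.exists_eq_add_of_le hrp
    rw [exponent_eq hrp, Nat.choose_two_right, Nat.add_sub_cancel, Nat.mul_comm (2 * m + 1) (2 * m),
      Nat.mul_assoc, Nat.mul_div_cancel_left _ (by norm_num)]
    have h1 : 2 * (2 * m + 1 + d) + 1 - 4 * m = 2 * d + 3 := by omega
    have h2 : 2 * m + 1 + d - m + 1 - (m + 1) = d + 1 := by omega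
    rw [h1, h2, Nat.add_sub_cancel_left]
    ring

theorem gamma_mul_prod (m : ℕ) {s : ℝ} (hs : -1 < s) {n : ℕ} (hmn : m + 1 ≤ n) :
    Real.Gamma (m + s + 1) * ∏ k ∈ Finset.Ico (m + 1) n, ((k : ℝ) + s) =
      Real.Gamma (n + s) := by
  induction n, hmn using Nat.le_induction with
  | base =>
    rw [Finset.Ico_self, Finset.prod_empty, mul_one]
    congr 1
    push_cast
    ring
  | succ n hn ih =>
    have hn1 : (1 : ℝ) ≤ n := by exact_mod_cast (by omega : 1 ≤ n)
    rw [Finset.prod_Ico_succ_top hn, ← mul_assoc, ih]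
    push_cast
    rw [show (n : ℝ) + 1 + s = n + s + 1 by ring,
      Real.Gamma_add_one (by linarith : (0 : ℝ) < n + s).ne']
    ring

theorem evenE1_mul_denomE1 {m p : ℕ} (hm : 2 * m ≤ p) {s : ℝ} (hs : -1 < s) :
    evenE1 (2 * m) p s * denomE1 (2 * m) p s = 1 := by
  have h := prod_poleOrder_even hm fun l => ((l : ℝ) + 2 * s)
  have h2 : ∏ l ∈ Finset.Icc 2 (2 * m), (((l : ℝ) + 2 * s) *
      (((2 * p + 2 - l : ℕ) : ℝ) + 2 * s)) ^ (l / 2) = ∏ l ∈ Finset.Icc 2 (2 * m),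
      (((l : ℝ) + 2 * s) * (2 * (p : ℝ) - (l : ℝ) + 2 + 2 * s)) ^ (l / 2) := by
    refine Finset.prod_congr rfl fun l hl => ?_
    have := Finset.mem_Icc.1 hl
    rw [Nat.cast_sub (by omega)]
    push_cast
    congr 2
    ring
  rw [h2] at h
  have hD := (denomE1_pos (r := 2 * m) (p := p) hs).ne'
  rw [denomE1] at hD ⊢
  rw [h] at hD ⊢
  rw [evenE1, Nat.mul_div_cancel_left _ (by norm_num)]
  simp only [one_div, Finset.prod_inv_distrib]
  rw [← mul_inv, inv_mul_cancel₀ hD]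

theorem exists_E1_mul_denomE1 {r p : ℕ} (hrp : r ≤ p) :
    ∃ κ : ℝ, κ ≠ 0 ∧ ∀ s : ℝ, -1 < s → E1 r p s * denomE1 r p s = κ := by
  rcases Nat.even_or_odd' r with ⟨m, rfl | rfl⟩
  · refine ⟨1, one_ne_zero, fun s hs => ?_⟩
    rw [E1, if_pos (even_two_mul m), evenE1_mul_denomE1 hrp hs]
  -- One factor `2` for each extra term `2k + 2s = 2(k + s)`.
  · refine ⟨2 ^ (p - m + 1 - (m + 1)), by positivity, fun s hs => ?_⟩
    have h := prod_poleOrder_odd hrp fun l => ((l : ℝ) + 2 * s)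
    have h1 : ∏ k ∈ Finset.Ico (m + 1) (p - m + 1), (((2 * k : ℕ) : ℝ) + 2 * s) =
        2 ^ (p - m + 1 - (m + 1)) * ∏ k ∈ Finset.Ico (m + 1) (p - m + 1), ((k : ℝ) + s) := by
      rw [← Nat.card_Ico (m + 1) (p - m + 1), ← Finset.prod_const, ← Finset.prod_mul_distrib]
      refine Finset.prod_congr rfl fun k _ => ?_
      push_cast
      ring
    have h2 := gamma_mul_prod m hs (show m + 1 ≤ p - m + 1 by omega)
    have h3 := evenE1_mul_denomE1 (show 2 * m ≤ p by omega) hs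
    have hp : (1 : ℝ) ≤ ((p - m + 1 : ℕ) : ℝ) := by exact_mod_cast (by omega : 1 ≤ p - m + 1)
    have hG : Real.Gamma (((p - m + 1 : ℕ) : ℝ) + s) ≠ 0 :=
      (Real.Gamma_pos_of_pos (by linarith)).ne'
    rw [E1, if_neg (by simp), Nat.add_sub_cancel, realFactorial, realFactorial, denomE1, h, h1]
    have e1 : (((2 * m + 1 : ℕ) : ℝ) - 1) / 2 + s + 1 = m + s + 1 := by
      push_cast
      ring
    have e2 : (p : ℝ) - (((2 * m + 1 : ℕ) : ℝ) - 1) / 2 + s + 1 = ((p - m + 1 : ℕ) : ℝ) + s := by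
      have : ((p - m : ℕ) : ℝ) = p - m := Nat.cast_sub (by omega)
      push_cast [this]
      ring
    rw [e1, e2]
    rw [denomE1] at h3
    calc _ = (Real.Gamma (m + s + 1) * ∏ k ∈ Finset.Ico (m + 1) (p - m + 1), ((k : ℝ) + s)) /
          Real.Gamma (((p - m + 1 : ℕ) : ℝ) + s) * (evenE1 (2 * m) p s *
          ∏ l ∈ Finset.Icc 2 (2 * p), ((l : ℝ) + 2 * s) ^ poleOrder (2 * m) p l) *
          2 ^ (p - m + 1 - (m + 1)) := by ring
      _ = _ := by rw [h2, h3, div_self hG, one_mul, one_mul]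

/-! ### Growth in `s` and proportionality to `E1` -/

/-- The closed form depends only on the set of variables, so the sum is unchanged by the permutation
`e`; the reversed order is needed at `s = 0`. -/
theorem hasSum_schur_rpow {r p : ℕ} (hrp : r ≤ p) {s : ℝ} (hs : -1 < s) {q : ℝ} (h0 : 0 < q)
    (h1 : q < 1) (e : Equiv.Perm (Fin p)) :
    HasSum (fun μ : BoundedPartition r =>
      schur μ.1 fun i : Fin p => q ^ (((e i : ℕ) : ℝ) + 1 + s))
      (boundedSum r Finset.univ fun i : Fin p => q ^ (((i : ℕ) : ℝ) + 1 + s)) := by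
  have hpos : ∀ a : Fin p, 0 < (a : ℝ) + 1 + s := fun a => by
    have : (0 : ℝ) ≤ (a : ℕ) := Nat.cast_nonneg _
    linarith
  have := hasSum_schur (x := fun i : Fin p => q ^ (((i : ℕ) : ℝ) + 1 + s)) (fun a b h => by
      have := (Real.strictAnti_rpow_of_base_lt_one h0 h1).injective h
      exact Fin.ext (Nat.cast_injective (R := ℝ) (by linarith)))
    (fun a => Real.rpow_pos_of_pos h0 _) (fun a => Real.rpow_lt_one h0.le h1 (hpos a)) r p hrp e
    e.injective
  rwa [Finset.image_univ_of_surjective e.surjective] at this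

attribute [local irreducible] schur in
-- Termwise monotonicity of Schur functions: `(1 + s)(i + 1) ≤ (p + 1)(i + 1 + s)` for `i < p`, so
-- each variable only grows when replaced.
theorem boundedSum_le {r p : ℕ} (hrp : r ≤ p) {s : ℝ} (hs : -1 < s) {q : ℝ} (h0 : 0 < q)
    (h1 : q < 1) :
    boundedSum r Finset.univ (fun i : Fin p => q ^ (((i : ℕ) : ℝ) + 1 + s)) ≤
      boundedSum r Finset.univ fun i : Fin p =>
        (q ^ ((1 + s) / (p + 1))) ^ (((i : ℕ) : ℝ) + 1 + 0) := by
  have hc : 0 < (1 + s) / ((p : ℝ) + 1) := by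
    have : (0 : ℝ) < (p : ℝ) + 1 := by positivity
    exact div_pos (by linarith) this
  have hA := hasSum_schur_rpow hrp hs h0 h1 (Equiv.refl _)
  have hB := hasSum_schur_rpow hrp (show (-1 : ℝ) < 0 by norm_num)
    (Real.rpow_pos_of_pos h0 ((1 + s) / ((p : ℝ) + 1))) (Real.rpow_lt_one h0.le h1 hc)
    (Equiv.refl _)
  refine hasSum_le (fun μ => ?_) hA hB
  refine schur_mono μ.1 (fun i => (Real.rpow_pos_of_pos h0 _).le) fun i => ?_
  rw [← Real.rpow_mul h0.le]
  refine Real.rpow_le_rpow_of_exponent_ge h0 h1.le ?_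
  have hi : ((i : ℕ) : ℝ) + 1 ≤ p := by exact_mod_cast i.2
  have hi0 : (0 : ℝ) ≤ ((i : ℕ) : ℝ) := Nat.cast_nonneg _
  change (1 + s) / (p + 1) * ((i : ℕ) + 1 + 0) ≤ (i : ℕ) + 1 + s
  rw [div_mul_eq_mul_div, div_le_iff₀ (by positivity)]
  nlinarith

theorem limitSum_mul_pow_le {r p : ℕ} (hrp : r ≤ p) {s : ℝ} (hs : -1 < s) :
    limitSum r p s * (1 + s) ^ (r * p - r.choose 2) ≤
      limitSum r p 0 * ((p : ℝ) + 1) ^ (r * p - r.choose 2) := by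
  set N := r * p - r.choose 2 with hN
  have hp : (0 : ℝ) < (p : ℝ) + 1 := by positivity
  set c := (1 + s) / ((p : ℝ) + 1) with hcdef
  have hc : 0 < c := div_pos (by linarith) hp
  have hpow : Filter.Tendsto (fun q : ℝ => q ^ c) (𝓝[<] 1) (𝓝[<] 1) := by
    refine tendsto_nhdsWithin_iff.2 ⟨?_, ?_⟩
    · have := (Real.continuousAt_rpow_const 1 c (Or.inl one_ne_zero)).tendsto
      rw [Real.one_rpow] at this
      exact this.mono_left nhdsWithin_le_nhds
    · filter_upwards [Ioo_mem_nhdsLT (one_pos : (0 : ℝ) < 1)] with q hq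
      exact Real.rpow_lt_one hq.1.le hq.2 hc
  have h1 := tendsto_boundedSum hrp hs
  have h2 := (tendsto_boundedSum hrp (show (-1 : ℝ) < 0 by norm_num)).comp hpow
  -- Changing the base from `q` to `q ^ c` costs the factor `((1 - q) / (1 - q ^ c)) ^ N`, which
  -- tends to `c⁻¹ ^ N`.
  have h3 := (((one_sub_mul_inv_tendsto hc.ne').pow N).mul h2)
  have h4 : limitSum r p s ≤ c⁻¹ ^ N * limitSum r p 0 := by
    refine le_of_tendsto_of_tendsto h1 h3 ?_
    filter_upwards [Ioo_mem_nhdsLT (one_pos : (0 : ℝ) < 1)] with q hq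
    have h5 : 1 - q ^ c ≠ 0 := by
      have := Real.rpow_lt_one hq.1.le hq.2 hc
      linarith
    have h6 := mul_le_mul_of_nonneg_left (boundedSum_le hrp hs hq.1 hq.2)
      (pow_nonneg (sub_nonneg.2 hq.2.le) N)
    refine h6.trans (le_of_eq ?_)
    rw [Function.comp_apply, ← mul_assoc, ← hN, ← mul_pow, mul_assoc, inv_mul_cancel₀ h5, mul_one]
  calc limitSum r p s * (1 + s) ^ N ≤ c⁻¹ ^ N * limitSum r p 0 * (1 + s) ^ N :=
        mul_le_mul_of_nonneg_right h4 (pow_nonneg (by linarith) _)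
    _ = limitSum r p 0 * (c⁻¹ * (1 + s)) ^ N := by
        rw [mul_pow]
        ring
    _ = _ := by
        have h7 : 1 + s ≠ 0 := by linarith
        rw [hcdef, inv_div, div_mul_cancel₀ _ h7]

theorem limitSum_nonneg {r p : ℕ} (hrp : r ≤ p) {s : ℝ} (hs : -1 < s) : 0 ≤ limitSum r p s := by
  refine ge_of_tendsto (tendsto_boundedSum hrp hs) ?_
  filter_upwards [Ioo_mem_nhdsLT (one_pos : (0 : ℝ) < 1)] with q hq
  refine mul_nonneg (pow_nonneg (sub_nonneg.2 hq.2.le) _) ?_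
  exact (hasSum_schur_rpow hrp hs hq.1 hq.2 (Equiv.refl _)).nonneg fun μ =>
    schur_nonneg _ fun i => (Real.rpow_pos_of_pos hq.1 _).le

/-- The product is a polynomial in `s`; the decay of `limitSum` cancels the growth of `denomE1`, so
it is bounded at infinity and therefore constant. -/
theorem limitSum_mul_denomE1_eq {r p : ℕ} (hrp : r ≤ p) {s : ℝ} (hs : -1 < s) :
    limitSum r p s * denomE1 r p s = limitSum r p 0 * denomE1 r p 0 := by
  set N := r * p - r.choose 2 with hN
  have hbound : ∀ s : ℝ, 0 ≤ s → |(numerPoly r p).eval s| ≤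
      limitSum r p 0 * ((p : ℝ) + 1) ^ N * (2 * p + 2) ^ N := by
    intro s hs
    have hs1 : -1 < s := by linarith
    rw [← limitSum_mul_denomE1 r p hs1,
      abs_of_nonneg (mul_nonneg (limitSum_nonneg hrp hs1) (denomE1_pos hs1).le)]
    have hD : denomE1 r p s ≤ ((1 + s) * (2 * p + 2)) ^ N := by
      rw [hN, ← prod_const_poleOrder hrp]
      refine Finset.prod_le_prod (fun l hl => pow_nonneg
        (factor_pos hs1 (Finset.mem_Icc.1 hl).1).le _) fun l hl => pow_le_pow_left₀
        (factor_pos hs1 (Finset.mem_Icc.1 hl).1).le ?_ _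
      have : (l : ℝ) ≤ 2 * p := by exact_mod_cast (Finset.mem_Icc.1 hl).2
      have hp0 : (0 : ℝ) ≤ p := Nat.cast_nonneg _
      nlinarith
    refine (mul_le_mul_of_nonneg_left hD (limitSum_nonneg hrp hs1)).trans ?_
    rw [mul_pow, ← mul_assoc]
    exact mul_le_mul_of_nonneg_right (limitSum_mul_pow_le hrp hs1) (by positivity)
  have hdeg : (numerPoly r p).degree ≤ 0 := by
    rw [← Polynomial.isBoundedUnder_abs_atTop_iff]
    refine Filter.isBoundedUnder_of_eventually_le
      (a := limitSum r p 0 * ((p : ℝ) + 1) ^ N * (2 * p + 2) ^ N) ?_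
    filter_upwards [Filter.eventually_ge_atTop (0 : ℝ)] with s hs
    exact hbound s hs
  rw [limitSum_mul_denomE1 r p hs, limitSum_mul_denomE1 r p (by norm_num),
    Polynomial.eq_C_of_degree_le_zero hdeg, Polynomial.eval_C, Polynomial.eval_C]

theorem limitSum_eq {r p : ℕ} (hrp : r ≤ p) {s : ℝ} (hs : -1 < s) :
    limitSum r p s = limitSum r p 0 * (E1 r p s / E1 r p 0) := by
  obtain ⟨κ, hκ, h⟩ := exists_E1_mul_denomE1 hrp
  have h0 := h 0 (by norm_num)
  have h1 := h s hs
  have h2 := limitSum_mul_denomE1_eq hrp hs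
  have d0 : denomE1 r p 0 ≠ 0 := (denomE1_pos (by norm_num)).ne'
  have d1 : denomE1 r p s ≠ 0 := (denomE1_pos hs).ne'
  have e0 : E1 r p 0 = κ / denomE1 r p 0 := by rw [← h0]; field_simp
  have e1 : E1 r p s = κ / denomE1 r p s := by rw [← h1]; field_simp
  rw [e0, e1, eq_div_of_mul_eq d1 h2]
  field_simp

/-! ### Plane partitions and standard fillings -/

section LinearExtensions

theorem card_stripColumns {r : ℕ} (z : ℕ × BoundedPartition r) :
    (stripColumns r z).1.card = (r + 1) * z.1 + z.2.1.card := by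
  rw [YoungDiagram.card_eq_sum_rowLen (stripColumns r z).2,
    YoungDiagram.card_eq_sum_rowLen (z.2.2.trans (Nat.le_succ r))]
  have : ∀ i : Fin (r + 1), (stripColumns r z).1.rowLen i = z.1 + z.2.1.rowLen i := fun i =>
    YoungDiagram.rowLen_addColumns i.2
  simp only [this, Finset.sum_add_distrib, Finset.sum_const, Finset.card_univ, Fintype.card_fin,
    smul_eq_mul]

theorem hasSum_pow_card {q : ℝ} (h0 : 0 < q) (h1 : q < 1) (n : ℕ) :
    HasSum (fun μ : BoundedPartition n => q ^ μ.1.card)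
      (∏ k ∈ Finset.range n, (1 - q ^ (k + 1))⁻¹) := by
  induction n with
  | zero =>
    have h : (fun μ : BoundedPartition 0 => q ^ μ.1.card) = fun _ => 1 := by
      funext μ
      rw [boundedPartition_zero μ, YoungDiagram.card, YoungDiagram.cells_bot, Finset.card_empty,
        pow_zero]
    rw [h, Finset.prod_range_zero]
    exact hasSum_unique _
  | succ n ih =>
    rw [← (stripColumns n).hasSum_iff, Finset.prod_range_succ, mul_comm]
    have hg := hasSum_geometric_of_lt_one (pow_nonneg h0.le (n + 1))
      (pow_lt_one₀ h0.le h1 (Nat.succ_ne_zero n))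
    have := HasSum.mul_nonneg_real (f := fun k : ℕ => (q ^ (n + 1)) ^ k)
      (g := fun μ : BoundedPartition n => q ^ μ.1.card) hg ih (fun k => by positivity)
      (fun μ => by positivity)
    have h : (fun μ : BoundedPartition (n + 1) => q ^ μ.1.card) ∘ stripColumns n =
        fun z => (q ^ (n + 1)) ^ z.1 * q ^ z.2.1.card := by
      funext z
      rw [Function.comp_apply, card_stripColumns, pow_add, pow_mul]
    rw [h]
    exact this

/-- Fillings of `D` by natural numbers, weakly decreasing along rows and down columns. -/
abbrev PlanePartition (D : Finset (ℕ × ℕ)) : Type :=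
  {f : D → ℕ // (∀ c d : D, c.1.1 = d.1.1 → c.1.2 < d.1.2 → f d ≤ f c) ∧
    ∀ c d : D, c.1.2 = d.1.2 → c.1.1 < d.1.1 → f d ≤ f c}

/-- Standard fillings of `D`. -/
abbrev StandardFilling (D : Finset (ℕ × ℕ)) : Type :=
  {T : D ≃ Fin D.card // IsStandardFilling T}

variable {D : Finset (ℕ × ℕ)}

/-- Sort the cells by decreasing value, breaking ties lexicographically by position. The ranks form
a standard filling and the sorted values a partition. This gives the upper bound. -/
theorem PlanePartition.exists_filling (f : PlanePartition D) :
    ∃ z : StandardFilling D × BoundedPartition D.card,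
      ∀ c, f.1 c = z.2.1.rowLen (z.1.1 c) := by
  let key : D → ℕᵒᵈ ×ₗ (ℕ ×ₗ ℕ) := fun c => toLex (OrderDual.toDual (f.1 c), toLex c.1)
  have hkey : Function.Injective key := by
    intro c d h
    have : toLex c.1 = toLex d.1 := congrArg (fun x => (ofLex x).2) h
    exact Subtype.ext (toLex.injective this)
  have hlt : ∀ c d : D, f.1 d ≤ f.1 c → toLex c.1 < toLex d.1 → key c < key d := by
    intro c d h1 h2
    rw [Prod.Lex.toLex_lt_toLex]
    rcases h1.eq_or_lt with h | h
    · exact Or.inr ⟨by simp [h], h2⟩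
    · exact Or.inl h
  let S := Finset.univ.image key
  have hS : S.card = D.card := by
    rw [Finset.card_image_of_injective _ hkey, Finset.card_univ, Fintype.card_coe]
  let e : D ≃ S := Equiv.ofBijective
    (fun c => ⟨key c, Finset.mem_image_of_mem key (Finset.mem_univ c)⟩)
    ⟨fun c d h => hkey (congrArg Subtype.val h), fun y => by
      obtain ⟨c, -, hc⟩ := Finset.mem_image.1 y.2
      exact ⟨c, Subtype.ext hc⟩⟩
  let o := S.orderIsoOfFin hS
  let w : Fin D.card ≃ D := o.toEquiv.trans e.symm
  have hw : ∀ c d : D, key c < key d → w.symm c < w.symm d := fun c d h =>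
    o.symm.strictMono (show e c < e d from h)
  have hkw : ∀ i, key (w i) = o i := fun i => congrArg Subtype.val (e.apply_symm_apply (o i))
  have hmono : ∀ i j : Fin D.card, i ≤ j → f.1 (w j) ≤ f.1 (w i) := by
    intro i j hij
    have h : key (w i) ≤ key (w j) := by
      rw [hkw, hkw]
      exact o.monotone hij
    rw [Prod.Lex.toLex_le_toLex] at h
    rcases h with h | h
    · exact le_of_lt h
    · exact le_of_eq (congrArg OrderDual.ofDual h.1).symm
  have hanti : Antitone fun i : ℕ => if h : i < D.card then f.1 (w ⟨i, h⟩) else 0 := by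
    intro i j hij
    by_cases hj : j < D.card
    · simp only [dif_pos hj, dif_pos (hij.trans_lt hj)]
      exact hmono _ _ hij
    · simp [hj]
  refine ⟨⟨⟨w.symm, fun c d h1 h2 => hw c d (hlt c d (f.2.1 c d h1 h2) ?_),
    fun c d h1 h2 => hw c d (hlt c d (f.2.2 c d h1 h2) ?_)⟩,
    ⟨YoungDiagram.ofAntitone D.card _ hanti, YoungDiagram.colLen_zero_le_iff.2 fun i k h =>
      (YoungDiagram.mem_ofAntitone.1 h).1⟩⟩, fun c => ?_⟩
  · exact Prod.Lex.toLex_lt_toLex.2 (Or.inr ⟨h1, h2⟩)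
  · exact Prod.Lex.toLex_lt_toLex.2 (Or.inl h2)
  · have := (w.symm c).2
    change _ = (YoungDiagram.ofAntitone D.card _ hanti).rowLen (w.symm c)
    rw [YoungDiagram.rowLen_ofAntitone this, dif_pos this]
    simp

theorem sum_rowLen_filling (w : D ≃ Fin D.card) (μ : BoundedPartition D.card) :
    ∑ c, μ.1.rowLen (w c) = μ.1.card := by
  rw [YoungDiagram.card_eq_sum_rowLen μ.2]
  exact w.sum_comp fun i : Fin D.card => μ.1.rowLen i

/-- The strictly decreasing filling attached to a standard filling and a partition. -/
def strictFilling (z : StandardFilling D × BoundedPartition D.card) : PlanePartition D :=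
  ⟨fun c => z.2.1.rowLen (z.1.1 c) + (D.card - 1 - z.1.1 c), by
    have h : ∀ c d : D, z.1.1 c < z.1.1 d →
        z.2.1.rowLen (z.1.1 d) + (D.card - 1 - z.1.1 d) ≤
          z.2.1.rowLen (z.1.1 c) + (D.card - 1 - z.1.1 c) := by
      intro c d h
      have h1 := z.2.1.rowLen_anti _ _ (le_of_lt h)
      have h2 : (z.1.1 c : ℕ) < z.1.1 d := h
      omega
    exact ⟨fun c d h1 h2 => h c d (z.1.2.1 c d h1 h2), fun c d h1 h2 => h c d (z.1.2.2 c d h1 h2)⟩⟩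

/-- The added staircase makes the values strictly decreasing along the order of the filling, so
their set determines the sorted sequence, and then the position of each value. This gives the lower
bound. -/
theorem strictFilling_injective : Function.Injective (strictFilling (D := D)) := by
  rintro ⟨⟨w, hw⟩, μ⟩ ⟨⟨w', hw'⟩, μ'⟩ h
  let G : BoundedPartition D.card → Fin D.card → ℕᵒᵈ := fun μ i =>
    OrderDual.toDual (μ.1.rowLen i + (D.card - 1 - i))
  have hG : ∀ μ, StrictMono (G μ) := by
    intro μ i j hij
    have h1 := μ.1.rowLen_anti _ _ (le_of_lt hij)
    have h2 : (i : ℕ) < j := hij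
    have h3 := j.2
    change μ.1.rowLen j + (D.card - 1 - j) < μ.1.rowLen i + (D.card - 1 - i)
    omega
  have hf : ∀ c, G μ (w c) = G μ' (w' c) := fun c =>
    congrFun (congrArg Subtype.val h) c
  have hr : Set.range (G μ) = Set.range (G μ') := by
    ext y
    constructor
    · rintro ⟨i, rfl⟩
      exact ⟨w' (w.symm i), by rw [← hf, w.apply_symm_apply]⟩
    · rintro ⟨i, rfl⟩
      exact ⟨w (w'.symm i), by rw [hf, w'.apply_symm_apply]⟩
  have hGG : G μ = G μ' := (StrictMono.range_inj (hG μ) (hG μ')).1 hr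
  have hww : w = w' := by
    ext c
    have := hf c
    rw [← hGG] at this
    rw [(hG μ).injective this]
  have hμ : μ = μ' := by
    refine Subtype.ext (YoungDiagram.ext_rowLen μ.2 μ'.2 fun i hi => ?_)
    have : μ.1.rowLen i + (D.card - 1 - i) = μ'.1.rowLen i + (D.card - 1 - i) :=
      congrArg OrderDual.ofDual (congrFun hGG ⟨i, hi⟩)
    omega
  subst hww hμ
  rfl

theorem sum_strictFilling (z : StandardFilling D × BoundedPartition D.card) :
    ∑ c, (strictFilling z).1 c = z.2.1.card + ∑ i : Fin D.card, (D.card - 1 - (i : ℕ)) := by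
  rw [← sum_rowLen_filling z.1.1 z.2,
    ← z.1.1.sum_comp fun i : Fin D.card => (D.card - 1 - (i : ℕ)), ← Finset.sum_add_distrib]
  rfl

theorem hasSum_filling {q : ℝ} (h0 : 0 < q) (h1 : q < 1) :
    HasSum (fun z : StandardFilling D × BoundedPartition D.card => q ^ z.2.1.card)
      (Nat.card (StandardFilling D) * ∏ k ∈ Finset.range D.card, (1 - q ^ (k + 1))⁻¹) := by
  have hfin : Fintype (StandardFilling D) := Fintype.ofFinite _
  have hs := hasSum_pow_card h0 h1 D.card
  have hc := hasSum_fintype fun _ : StandardFilling D => (1 : ℝ)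
  have := HasSum.mul_nonneg_real (f := fun _ : StandardFilling D => (1 : ℝ))
    (g := fun μ : BoundedPartition D.card => q ^ μ.1.card) hc hs (fun _ => zero_le_one)
    (fun μ => by positivity)
  have e : ∑ _z : StandardFilling D, (1 : ℝ) = Nat.card (StandardFilling D) := by
    rw [Finset.sum_const, Finset.card_univ, nsmul_one, Nat.card_eq_fintype_card]
  rw [e] at this
  simp only [one_mul] at this
  exact this

theorem summable_planePartition {q : ℝ} (h0 : 0 < q) (h1 : q < 1) :
    Summable fun f : PlanePartition D => q ^ ∑ c, f.1 c := by
  choose φ hφ using PlanePartition.exists_filling (D := D)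
  have hinj : Function.Injective φ := fun f g h =>
    Subtype.ext (funext fun c => by rw [hφ f, hφ g, h])
  have := (hasSum_filling (D := D) h0 h1).summable.comp_injective hinj
  refine this.congr fun f => ?_
  rw [Function.comp_apply, ← sum_rowLen_filling (φ f).1.1]
  simp only [hφ f]

theorem tsum_planePartition_le {q : ℝ} (h0 : 0 < q) (h1 : q < 1) :
    ∑' f : PlanePartition D, q ^ ∑ c, f.1 c ≤
      Nat.card (StandardFilling D) * ∏ k ∈ Finset.range D.card, (1 - q ^ (k + 1))⁻¹ := by
  choose φ hφ using PlanePartition.exists_filling (D := D)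
  have hinj : Function.Injective φ := fun f g h =>
    Subtype.ext (funext fun c => by rw [hφ f, hφ g, h])
  refine hasSum_le_inj φ hinj (fun _ _ => pow_nonneg h0.le _) (fun f => le_of_eq ?_)
    (summable_planePartition h0 h1).hasSum (hasSum_filling h0 h1)
  rw [← sum_rowLen_filling (φ f).1.1]
  simp only [hφ f]

theorem le_tsum_planePartition {q : ℝ} (h0 : 0 < q) (h1 : q < 1) :
    q ^ (∑ i : Fin D.card, (D.card - 1 - (i : ℕ))) * (Nat.card (StandardFilling D) *
      ∏ k ∈ Finset.range D.card, (1 - q ^ (k + 1))⁻¹) ≤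
    ∑' f : PlanePartition D, q ^ ∑ c, f.1 c := by
  refine hasSum_le_inj strictFilling strictFilling_injective (fun _ _ => pow_nonneg h0.le _)
    (fun z => le_of_eq ?_) ((hasSum_filling h0 h1).mul_left _)
    (summable_planePartition h0 h1).hasSum
  rw [sum_strictFilling, pow_add, mul_comm]

/-- The two bounds differ only by a fixed power of `q`, which tends to `1`, while `∏ (1 - q) / (1 -
q ^ k)` tends to the inverse factorial. -/
theorem tendsto_tsum_planePartition :
    Filter.Tendsto (fun q : ℝ => (1 - q) ^ D.card * ∑' f : PlanePartition D, q ^ ∑ c, f.1 c)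
      (𝓝[<] 1) (𝓝 (Nat.card (StandardFilling D) / D.card.factorial)) := by
  have hC : Filter.Tendsto (fun q : ℝ => (1 - q) ^ D.card *
      ∏ k ∈ Finset.range D.card, (1 - q ^ (k + 1))⁻¹) (𝓝[<] 1)
      (𝓝 ((D.card.factorial : ℝ)⁻¹)) := by
    have h1 : ((D.card.factorial : ℝ)⁻¹) = ∏ k ∈ Finset.range D.card, (((k + 1 : ℕ) : ℝ))⁻¹ := by
      rw [← Finset.prod_range_add_one_eq_factorial, Nat.cast_prod, Finset.prod_inv_distrib]
    rw [h1]
    have := tendsto_finsetProd (Finset.range D.card) fun k _ =>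
      one_sub_mul_inv_tendsto (c := ((k + 1 : ℕ) : ℝ)) (Nat.cast_ne_zero.2 (Nat.succ_ne_zero k))
    refine this.congr fun q => ?_
    simp only [Real.rpow_natCast, Finset.prod_mul_distrib, Finset.prod_const, Finset.card_range]
  have hU := hC.const_mul (Nat.card (StandardFilling D) : ℝ)
  have hq : Filter.Tendsto (fun q : ℝ => q ^ (∑ i : Fin D.card, (D.card - 1 - (i : ℕ))))
      (𝓝[<] 1) (𝓝 1) := by
    have := (continuous_pow (M := ℝ) (∑ i : Fin D.card, (D.card - 1 - (i : ℕ)))).tendsto 1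
    rw [one_pow] at this
    exact this.mono_left nhdsWithin_le_nhds
  have hL := hq.mul hU
  rw [one_mul] at hL
  rw [div_eq_mul_inv]
  refine tendsto_of_tendsto_of_tendsto_of_le_of_le' hL hU ?_ ?_
  · filter_upwards [Ioo_mem_nhdsLT (one_pos : (0 : ℝ) < 1)] with q hq
    have := mul_le_mul_of_nonneg_left (le_tsum_planePartition (D := D) hq.1 hq.2)
      (pow_nonneg (sub_nonneg.2 hq.2.le) D.card)
    refine le_trans (le_of_eq ?_) this
    ring
  · filter_upwards [Ioo_mem_nhdsLT (one_pos : (0 : ℝ) < 1)] with q hq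
    have := mul_le_mul_of_nonneg_left (tsum_planePartition_le (D := D) hq.1 hq.2)
      (pow_nonneg (sub_nonneg.2 hq.2.le) D.card)
    refine le_trans this (le_of_eq ?_)
    ring

end LinearExtensions

/-! ### Tableaux as plane partitions on the shifted staircase -/

section ShiftedFillings

variable {r p : ℕ}

/-- The shifted diagram of shape `(p, p - 1, …, p - r + 1)`. -/
abbrev staircase (r p : ℕ) : Finset (ℕ × ℕ) := shiftedDiagram fun i : Fin r => p - (i : ℕ)

theorem mem_staircase (hrp : r ≤ p) {i j : ℕ} : (i, j) ∈ staircase r p ↔ i < r ∧ i ≤ j ∧ j < p := by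
  simp only [staircase, shiftedDiagram, Finset.mem_biUnion, Finset.mem_univ, true_and,
    Finset.mem_product, Finset.mem_singleton, Finset.mem_Ico]
  constructor
  · rintro ⟨k, rfl, h1, h2⟩
    have := k.2
    exact ⟨this, h1, by omega⟩
  · rintro ⟨h1, h2, h3⟩
    exact ⟨⟨i, h1⟩, rfl, h2, by
      change j < i + (p - i)
      omega⟩

theorem card_staircase (hrp : r ≤ p) : (staircase r p).card = r * p - r.choose 2 := by
  rw [staircase, shiftedDiagram, Finset.card_biUnion]
  · simp only [Finset.card_product, Finset.card_singleton, Nat.card_Ico, one_mul,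
      Nat.add_sub_cancel_left]
    rw [Fin.sum_univ_eq_sum_range fun i => p - i]
    have h : ∀ r ≤ p, ∑ i ∈ Finset.range r, (p - i) + r.choose 2 = r * p := by
      intro r hr
      induction r with
      | zero => simp
      | succ r ih =>
        have := ih (by omega)
        rw [Finset.sum_range_succ, Nat.choose_succ_succ', Nat.choose_one_right, Nat.succ_mul,
          one_add_one_eq_two]
        omega
    have := h r hrp
    omega
  · intro i _ j _ hij
    refine Finset.disjoint_left.2 fun c h1 h2 => hij (Fin.ext ?_)
    have a := (Finset.mem_product.1 h1).1
    have b := (Finset.mem_product.1 h2).1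
    rw [Finset.mem_singleton] at a b
    omega

/-- The filling of the staircase recording, for each row of a tableau, the numbers of entries
smaller than given bounds. -/
def tableauFilling (z : Σ μ : BoundedPartition r, BoundedSSYT p μ.1) :
    PlanePartition (staircase r p) :=
  -- In row `i` the letters lie in `[i, p)`, and the bounds `p - j + i` run from `p` at `j = i` (the
  -- whole row) down to `i + 1`. Going down a row raises the bound by one, which strictness of
  -- columns compensates.
  ⟨fun c => (z.2.1.below (p - c.1.2 + c.1.1)).rowLen c.1.1, by
    constructor
    · rintro ⟨⟨i, j⟩, hc⟩ ⟨⟨i', j'⟩, hd⟩ h1 h2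
      simp only at h1 h2 ⊢
      subst h1
      refine le_of_forall_lt fun k hk => ?_
      rw [← YoungDiagram.mem_iff_lt_rowLen, SemistandardYoungTableau.mem_below] at hk ⊢
      exact ⟨hk.1, by omega⟩
    · rintro ⟨⟨i, j⟩, hc⟩ ⟨⟨i', j'⟩, hd⟩ h1 h2
      simp only at h1 h2 ⊢
      subst h1
      refine le_of_forall_lt fun k hk => ?_
      rw [← YoungDiagram.mem_iff_lt_rowLen, SemistandardYoungTableau.mem_below] at hk ⊢
      refine ⟨z.1.1.up_left_mem h2.le le_rfl hk.1, ?_⟩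
      obtain ⟨d, rfl⟩ := Nat.exists_eq_add_of_le h2.le
      have := z.2.1.add_le d hk.1
      omega⟩

theorem lt_tableauFilling_iff (z : Σ μ : BoundedPartition r, BoundedSSYT p μ.1)
    (c : staircase r p) {k : ℕ} : k < (tableauFilling z).1 c ↔
      (c.1.1, k) ∈ z.1.1 ∧ z.2.1 c.1.1 k < p - c.1.2 + c.1.1 := by
  rw [← SemistandardYoungTableau.mem_below, YoungDiagram.mem_iff_lt_rowLen]
  rfl

theorem tableauFilling_injective (hrp : r ≤ p) :
    Function.Injective (tableauFilling (r := r) (p := p)) := by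
  rintro ⟨⟨μ, hμ⟩, T⟩ ⟨⟨μ', hμ'⟩, T'⟩ h
  have key : ∀ i j k, i < r → i ≤ j → j < p →
      ((i, k) ∈ μ ∧ T.1 i k < p - j + i ↔ (i, k) ∈ μ' ∧ T'.1 i k < p - j + i) := by
    intro i j k h1 h2 h3
    have a := lt_tableauFilling_iff ⟨⟨μ, hμ⟩, T⟩
      ⟨(i, j), (mem_staircase hrp).2 ⟨h1, h2, h3⟩⟩ (k := k)
    have b := lt_tableauFilling_iff ⟨⟨μ', hμ'⟩, T'⟩
      ⟨(i, j), (mem_staircase hrp).2 ⟨h1, h2, h3⟩⟩ (k := k)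
    rw [h] at a
    exact a.symm.trans b
  have hrow : μ = μ' := by
    ext ⟨i, k⟩
    rw [YoungDiagram.mem_cells, YoungDiagram.mem_cells]
    constructor
    · intro hm
      have hi := YoungDiagram.colLen_zero_le_iff.1 hμ i k hm
      have hT : T.1 i k < p := T.2 _ hm
      exact ((key i i k hi le_rfl (by omega)).1 ⟨hm, by omega⟩).1
    · intro hm
      have hi := YoungDiagram.colLen_zero_le_iff.1 hμ' i k hm
      have hT : T'.1 i k < p := T'.2 _ hm
      exact ((key i i k hi le_rfl (by omega)).2 ⟨hm, by omega⟩).1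
  subst hrow
  have hTT : T = T' := by
    refine BoundedSSYT.ext_entry fun i k hm => ?_
    have hi := YoungDiagram.colLen_zero_le_iff.1 hμ i k hm
    have h1 : T.1 i k < p := T.2 _ hm
    have h2 : T'.1 i k < p := T'.2 _ hm
    have h3 := T.1.le_apply hm
    have h4 := T'.1.le_apply hm
    rcases lt_trichotomy (T.1 i k) (T'.1 i k) with h | h | h
    -- This column makes the bound equal to the larger of the two entries, which separates them.
    · have := ((key i (p + i - T'.1 i k) k hi (by omega) (by omega)).1 ⟨hm, by omega⟩).2
      omega
    · exact h
    · have := ((key i (p + i - T.1 i k) k hi (by omega) (by omega)).2 ⟨hm, by omega⟩).2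
      omega
  subst hTT
  rfl

theorem lt_add_card_filter_iff {i p : ℕ} {P : ℕ → Prop} [DecidablePred P]
    (hP : ∀ j j', i ≤ j → j ≤ j' → j' < p → P j' → P j) {j : ℕ} (h1 : i ≤ j) (h2 : j < p) :
    j < i + ((Finset.Ico i p).filter P).card ↔ P j := by
  constructor
  · intro h
    by_contra hj
    have : (Finset.Ico i p).filter P ⊆ Finset.Ico i j := by
      intro l hl
      obtain ⟨a, b⟩ := Finset.mem_filter.1 hl
      have a := Finset.mem_Ico.1 a
      refine Finset.mem_Ico.2 ⟨a.1, ?_⟩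
      by_contra hlj
      exact hj (hP j l h1 (not_lt.1 hlj) a.2 b)
    have := Finset.card_le_card this
    rw [Nat.card_Ico] at this
    omega
  · intro h
    have : Finset.Ico i (j + 1) ⊆ (Finset.Ico i p).filter P := by
      intro l hl
      have a := Finset.mem_Ico.1 hl
      exact Finset.mem_filter.2 ⟨Finset.mem_Ico.2 (by omega), hP l j a.1 (by omega) h2 h⟩
    have := Finset.card_le_card this
    rw [Nat.card_Ico] at this
    omega

theorem tableauFilling_surjective (hrp : r ≤ p) :
    Function.Surjective (tableauFilling (r := r) (p := p)) := by
  intro f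
  let F : ℕ → ℕ → ℕ := fun i j =>
    if h : (i, j) ∈ staircase r p then f.1 ⟨(i, j), h⟩ else 0
  have hF : ∀ i j (h : (i, j) ∈ staircase r p), F i j = f.1 ⟨(i, j), h⟩ := fun i j h => dif_pos h
  have hF0 : ∀ i j, r ≤ i → F i j = 0 := fun i j h =>
    dif_neg fun h' => by have := ((mem_staircase hrp).1 h').1; omega
  have hrow : ∀ i j j', i ≤ j → j ≤ j' → j' < p → F i j' ≤ F i j := by
    intro i j j' h1 h2 h3
    rcases lt_or_ge i r with hi | hi
    · have hc := (mem_staircase hrp).2 ⟨hi, h1, h2.trans_lt h3⟩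
      have hd := (mem_staircase hrp).2 ⟨hi, h1.trans h2, h3⟩
      rcases h2.eq_or_lt with rfl | h2
      · exact le_rfl
      · rw [hF _ _ hc, hF _ _ hd]
        exact f.2.1 _ _ rfl h2
    · rw [hF0 _ _ hi]
      exact Nat.zero_le _
  have hcol : ∀ i i' j, i ≤ i' → i' ≤ j → j < p → F i' j ≤ F i j := by
    intro i i' j h1 h2 h3
    rcases lt_or_ge i' r with hi | hi
    · have hc := (mem_staircase hrp).2 ⟨h1.trans_lt hi, h1.trans h2, h3⟩
      have hd := (mem_staircase hrp).2 ⟨hi, h2, h3⟩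
      rcases h1.eq_or_lt with rfl | h1
      · exact le_rfl
      · rw [hF _ _ hc, hF _ _ hd]
        exact f.2.2 _ _ rfl h1
    · rw [hF0 _ _ hi]
      exact Nat.zero_le _
  have hanti : Antitone fun i => F i i := by
    refine antitone_nat_of_succ_le fun i => ?_
    rcases lt_or_ge (i + 1) r with hi | hi
    · exact (hcol i (i + 1) (i + 1) (by omega) le_rfl (by omega)).trans
        (hrow i i (i + 1) le_rfl (by omega) (by omega))
    · simp only [hF0 _ _ hi]
      exact Nat.zero_le _
  let μ := YoungDiagram.ofAntitone r (fun i => F i i) hanti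
  have hμ : ∀ {i k}, (i, k) ∈ μ ↔ i < r ∧ k < F i i := YoungDiagram.mem_ofAntitone
  -- Since the rows of `F` decrease weakly, the columns counted form an initial segment of `[i, p)`,
  -- and the entry `p - N i k` is the one whose bounds are exceeded precisely there.
  let N : ℕ → ℕ → ℕ := fun i k => ((Finset.Ico i p).filter fun j => k < F i j).card
  have hN : ∀ i k j, i ≤ j → j < p → (j < i + N i k ↔ k < F i j) := fun i k j h1 h2 =>
    lt_add_card_filter_iff (fun j j' a b c h => h.trans_le (hrow i j j' a b c)) h1 h2
  have hNle : ∀ i k, N i k ≤ p - i := fun i k => by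
    have := Finset.card_filter_le (Finset.Ico i p) fun j => k < F i j
    rwa [Nat.card_Ico] at this
  have hNpos : ∀ {i k}, (i, k) ∈ μ → 0 < N i k := by
    intro i k hm
    obtain ⟨h1, h2⟩ := hμ.1 hm
    have := (hN i k i le_rfl (by omega)).2 h2
    omega
  let T : SemistandardYoungTableau μ :=
    { entry := fun i k => if (i, k) ∈ μ then p - N i k else 0
      row_weak' := by
        intro i k k' hk hm
        rw [if_pos hm, if_pos (μ.up_left_mem le_rfl hk.le hm)]
        refine Nat.sub_le_sub_left (Finset.card_le_card ?_) p
        exact Finset.monotone_filter_right _ fun j _ h => hk.trans h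
      col_strict' := by
        intro i i' k hi hm
        rw [if_pos hm, if_pos (μ.up_left_mem hi.le le_rfl hm)]
        have h0 := hNpos hm
        have h1 := hNle i' k
        have h2 := hNle i k
        -- The last column counted in the lower row is also counted in the upper row, whose segment
        -- starts further left; this makes the entry strictly smaller there.
        have h3 := (hN i' k (i' + N i' k - 1) (by omega) (by omega)).1 (by omega)
        have h4 := (hN i k (i' + N i' k - 1) (by omega) (by omega)).2
          (h3.trans_le (hcol i i' _ hi.le (by omega) (by omega)))
        omega
      zeros' := fun hm => if_neg hm }
  have hT : ∀ {i k}, (i, k) ∈ μ → T i k = p - N i k := fun hm => if_pos hm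
  refine ⟨⟨⟨μ, YoungDiagram.colLen_zero_le_iff.2 fun i k h => (hμ.1 h).1⟩, ⟨T, ?_⟩⟩, ?_⟩
  · rintro ⟨i, k⟩ hm
    have h0 := hNpos hm
    have h1 := hNle i k
    rw [hT hm]
    omega
  · refine Subtype.ext (funext ?_)
    rintro ⟨⟨i, j⟩, hc⟩
    obtain ⟨h1, h2, h3⟩ := (mem_staircase hrp).1 hc
    refine eq_of_forall_lt_iff fun k => ?_
    rw [lt_tableauFilling_iff, ← hF _ _ hc, ← hN i k j h2 h3]
    constructor
    · rintro ⟨hm, h⟩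
      have hm : (i, k) ∈ μ := hm
      have h : T i k < p - j + i := h
      rw [hT hm] at h
      have := hNle i k
      omega
    · intro h
      have hm : (i, k) ∈ μ :=
        hμ.2 ⟨h1, ((hN i k j h2 h3).1 h).trans_le (hrow i i j le_rfl h2 h3)⟩
      refine ⟨hm, ?_⟩
      change T i k < p - j + i
      rw [hT hm]
      omega

/-- Double counting: an entry `t` in row `i` is counted at the columns `j` with `i ≤ j < p + i - t`,
which are `p - t` in number. -/
theorem sum_tableauFilling (hrp : r ≤ p) (z : Σ μ : BoundedPartition r, BoundedSSYT p μ.1) :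
    ∑ c, (tableauFilling z).1 c = ∑ c ∈ z.1.1.cells, (p - z.2.1 c.1 c.2) := by
  have h1 : ∀ d ∈ staircase r p, (z.2.1.below (p - d.2 + d.1)).rowLen d.1 =
      (z.1.1.cells.bipartiteAbove
        (fun d c : ℕ × ℕ => c.1 = d.1 ∧ z.2.1 c.1 c.2 < p - d.2 + d.1) d).card := by
    intro d _
    rw [YoungDiagram.rowLen_eq_card]
    congr 1
    ext ⟨i, k⟩
    rw [YoungDiagram.mem_row_iff, SemistandardYoungTableau.mem_below, Finset.mem_bipartiteAbove,
      YoungDiagram.mem_cells]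
    tauto
  have h2 : ∑ c, (tableauFilling z).1 c =
      ∑ d ∈ staircase r p, (z.2.1.below (p - d.2 + d.1)).rowLen d.1 :=
    Finset.sum_coe_sort (staircase r p) fun d => (z.2.1.below (p - d.2 + d.1)).rowLen d.1
  rw [h2, Finset.sum_congr rfl h1, Finset.sum_card_bipartiteAbove_eq_sum_card_bipartiteBelow]
  refine Finset.sum_congr rfl ?_
  rintro ⟨i, k⟩ hc
  have hi := YoungDiagram.colLen_zero_le_iff.1 z.1.2 i k hc
  have hT : z.2.1 i k < p := z.2.2 _ hc
  have hT' := z.2.1.le_apply hc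
  have : (staircase r p).bipartiteBelow
      (fun d c : ℕ × ℕ => c.1 = d.1 ∧ z.2.1 c.1 c.2 < p - d.2 + d.1) (i, k) =
      {i} ×ˢ Finset.Ico i (p + i - z.2.1 i k) := by
    ext ⟨i', j⟩
    rw [Finset.mem_bipartiteBelow, mem_staircase hrp, Finset.mem_product, Finset.mem_singleton,
      Finset.mem_Ico]
    constructor
    · rintro ⟨⟨a, b, c⟩, d, e⟩
      simp only at d e ⊢
      subst d
      omega
    · rintro ⟨a, b, c⟩
      simp only at a b c ⊢
      subst a
      omega
  rw [this, Finset.card_product, Finset.card_singleton, Nat.card_Ico, one_mul]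
  simp only
  omega

theorem prod_extendOne_rev {q : ℝ} {μ : YoungDiagram} (T : BoundedSSYT p μ) :
    ∏ c ∈ μ.cells, extendOne (fun i : Fin p => q ^ (((Fin.revPerm i : ℕ) : ℝ) + 1 + 0))
      (T.1 c.1 c.2) = q ^ ∑ c ∈ μ.cells, (p - T.1 c.1 c.2) := by
  rw [← Finset.prod_pow_eq_pow_sum]
  refine Finset.prod_congr rfl fun c hc => ?_
  have h := T.2 c hc
  rw [extendOne_of_lt _ h, add_zero, ← Nat.cast_add_one, Real.rpow_natCast, Fin.revPerm_apply,
    Fin.val_rev]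
  congr 1
  simp only
  omega

/-- A letter `t` carries weight `q ^ (p - t)`, so the variables are `q, …, q ^ p` in reverse order,
and symmetry of the sum restores the order. -/
theorem tsum_planePartition_eq (hrp : r ≤ p) {q : ℝ} (h0 : 0 < q) (h1 : q < 1) :
    ∑' f : PlanePartition (staircase r p), q ^ ∑ c, f.1 c =
      boundedSum r Finset.univ fun i : Fin p => q ^ (((i : ℕ) : ℝ) + 1 + 0) := by
  let Φ := Equiv.ofBijective (tableauFilling)
    ⟨tableauFilling_injective hrp, tableauFilling_surjective hrp⟩
  have hs := (summable_planePartition (D := staircase r p) h0 h1).hasSum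
  rw [← Φ.hasSum_iff] at hs
  have h2 : ((fun f : PlanePartition (staircase r p) => q ^ ∑ c, f.1 c) ∘ Φ) =
      fun z => ∏ c ∈ z.1.1.cells, extendOne
        (fun i : Fin p => q ^ (((Fin.revPerm i : ℕ) : ℝ) + 1 + 0)) (z.2.1 c.1 c.2) := by
    funext z
    rw [prod_extendOne_rev, ← sum_tableauFilling hrp]
    rfl
  rw [h2] at hs
  have h3 := hs.sigma fun μ => hasSum_fintype _
  refine h3.unique ?_
  have h4 := hasSum_schur_rpow hrp (show (-1 : ℝ) < 0 by norm_num) h0 h1 Fin.revPerm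
  simp only [schur_eq_sum] at h4
  exact h4

theorem limitSum_zero (hrp : r ≤ p) : limitSum r p 0 =
    (numShiftedSYT (fun i : Fin r => p - (i : ℕ)) : ℝ) / ((r * p - r.choose 2).factorial : ℝ) := by
  refine tendsto_nhds_unique (tendsto_boundedSum hrp (by norm_num)) ?_
  have h := tendsto_tsum_planePartition (D := staircase r p)
  rw [card_staircase hrp] at h
  refine h.congr' ?_
  filter_upwards [Ioo_mem_nhdsLT (one_pos : (0 : ℝ) < 1)] with q hq
  rw [tsum_planePartition_eq hrp hq.1 hq.2]

end ShiftedFillings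

/-! ### Conclusion -/

theorem mainTheorem4 (r p N : ℕ) (hrp : r ≤ p) (hN : N = r * p - r.choose 2)
    (s : ℝ) (hs : -1 < s) :
    (∀ q : ℝ, 0 < q → q < 1 →
      Summable fun μ : {μ : YoungDiagram // μ.colLen 0 ≤ r} =>
        schur μ.1 fun i : Fin p => q ^ (((i : ℕ) : ℝ) + 1 + s)) ∧
    Filter.Tendsto
      (fun q : ℝ => (1 - q) ^ N *
        ∑' μ : {μ : YoungDiagram // μ.colLen 0 ≤ r},
          schur μ.1 fun i : Fin p => q ^ (((i : ℕ) : ℝ) + 1 + s))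
      (𝓝[<] 1)
      (𝓝 ((numShiftedSYT (fun i : Fin r => p - (i : ℕ)) : ℝ) / (N.factorial : ℝ) *
        (E1 r p s / E1 r p 0))) := by
  have hsum := fun (q : ℝ) (h0 : 0 < q) (h1 : q < 1) =>
    hasSum_schur_rpow hrp hs h0 h1 (Equiv.refl _)
  refine ⟨fun q h0 h1 => (hsum q h0 h1).summable, ?_⟩
  subst hN
  rw [← limitSum_zero hrp, ← limitSum_eq hrp hs]
  refine (tendsto_boundedSum hrp hs).congr' ?_
  filter_upwards [Ioo_mem_nhdsLT (one_pos : (0 : ℝ) < 1)] with q hq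
  exact congrArg _ (hsum q hq.1 hq.2).tsum_eq.symm
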